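/- Let $R=\mathbb Z[q^{\pm1},(q-1)^{-1}]$. A finite graded subset of $\mathbb R$, up to isotopy, is a finite sequence of integers (the degrees of its points, listed from bottom to top). A graded Legendrian tangle in $J^1[0,1]$ from $X$ (left boundary) to $Y$ (right boundary) is described by its front: a horizontal composition, from left to right, of basic tangles, each of which consists of horizontal strands together with exactly one elementary tangle, namely a crossing $\sigma_{m,n}$ (a strand of degree $m$ going from lower left to upper right crosses a strand of degree $n$ going from upper left to lower right), a left cusp $\lambda_n$, or a right cusp $\rho_n$ (at both kinds of cusp the upper branch has degree $n$ and the lower branch degree $n+1$). Isotopy of tangles is the equivalence relation generated by sliding an elementary tangle past another one above or below it and by the three Legendrian Reidemeister moves. The skein $\mathfrak T(X,Y)$ is the free $R$-module on isotopy classes of tangles from $X$ to $Y$ modulo the following local relations, in which horizontal compositions are read from left to right: * (S1) on a lower strand of degree $n+1$ and an upper strand of degree $m$, $$1-q^{(-1)^{m-n}}\,\sigma_{n+1,m}\sigma_{m,n+1}=\delta_{m,n}(q-1)\,\rho_m\lambda_m-\delta_{m,n+1}(1-q^{-1})\,\sigma_{m,m};$$ * (S2) a closed component $\lambda_n\rho_n$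 can be removed at the cost of a factor $(q-1)^{-1}$; * (S3) a tangle containing a zigzag (a strand that enters a right cusp along its upper branch, leaves that cusp along its lower branch, which is the upper branch of a left cusp, and leaves the latter along its lower branch) is zero. No boundary skein relations are imposed. The skein of tangles is $\mathfrak T=\bigoplus_{X,Y}\mathfrak T(X,Y)$. A right cusp tangle is a tangle with a single right cusp and no left cusps such that every crossing involves at least one of the two strands starting at the cusp, these two strands do not cross each other, and no pair of strands crosses twice. A left cusp tangle is the mirror image, under reflection of the front in a vertical axis, of a right cusp tangle. A permutation braid is a tangle without cusps in which every pair of strands crosses at most once. **Proposition.** For all $X,Y$, the $R$-module $\mathfrak T(X,Y)$ is generated by the classes of tangles which are a horizontal composition, from left to right, of (1) a finite, possibly empty, sequence of right cusp tangles, (2) a permutation braid, (3) a finite, possibly empty, sequence of left cusp tangles. Consequently $\mathfrak T$ is generated as an $R$-module by tangles of this form. -/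

import Mathlib

namespace LegendrianTangle

/-! ### The ground ring `ℤ[q^±, (q-1)⁻¹]` -/

/-- The ring `ℤ[q^±, (q-1)⁻¹]`: the polynomial ring in one variable with the variable `q` and
`q - 1` inverted. -/
abbrev SkeinRing : Type :=
  Localization.Away (Polynomial.X * (Polynomial.X - 1) : Polynomial ℤ)

theorem isUnit_algebraMap_mul :
    IsUnit (algebraMap (Polynomial ℤ) SkeinRing Polynomial.X *
      (algebraMap (Polynomial ℤ) SkeinRing Polynomial.X - 1)) := by
  have h := IsLocalization.Away.algebraMap_isUnit (S := SkeinRing)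
    (Polynomial.X * (Polynomial.X - 1) : Polynomial ℤ)
  simpa using h

/-- The variable `q`, as a unit of the ground ring. -/
noncomputable def q : SkeinRingˣ := (isUnit_of_mul_isUnit_left isUnit_algebraMap_mul).unit

/-- The element `q - 1`, as a unit of the ground ring. -/
noncomputable def qSubOne : SkeinRingˣ := (isUnit_of_mul_isUnit_right isUnit_algebraMap_mul).unit

theorem coe_q : (q : SkeinRing) = algebraMap (Polynomial ℤ) SkeinRing Polynomial.X := rfl

theorem coe_qSubOne : (qSubOne : SkeinRing) = (q : SkeinRing) - 1 := rfl

/-! ### Graded tangles, drawn in the front projection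

A finite graded subset of `ℝ` up to isotopy is the list of the degrees of its points, read from
bottom to top. The positive `x`-axis points to the right, the positive `z`-axis points up. -/

/-- The elementary tangles other than the single horizontal strand.
* `crossing m n` (`σ_{m,n}`): a strand of degree `m` from the lower left to the upper right crosses
  a strand of degree `n` from the upper left to the lower right.
* `leftCusp n` (`λ_n`): a left cusp `≺`, upper branch of degree `n`, lower branch of degree `n + 1`.
* `rightCusp n` (`ρ_n`): a right cusp `≻`, upper branch of degree `n`, lower branch of degree
  `n + 1`. -/
inductive Elem : Type
  | crossing (m n : ℤ) : Elem
  | leftCusp (n : ℤ) : Elem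
  | rightCusp (n : ℤ) : Elem
  deriving DecidableEq

namespace Elem

/-- Left boundary, from bottom to top. -/
def src : Elem → List ℤ
  | crossing m n => [m, n]
  | leftCusp _ => []
  | rightCusp n => [n + 1, n]

/-- Right boundary, from bottom to top. -/
def tgt : Elem → List ℤ
  | crossing m n => [n, m]
  | leftCusp n => [n + 1, n]
  | rightCusp _ => []

/-- Reflection of the front in a vertical axis. -/
def mirror : Elem → Elem
  | crossing m n => crossing n m
  | leftCusp n => rightCusp n
  | rightCusp n => leftCusp n

end Elem

/-- A basic tangle: one non-identity elementary tangle with horizontal strands of degrees `lower`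
below it and of degrees `upper` above it. -/
structure Basic : Type where
  lower : List ℤ
  elem : Elem
  upper : List ℤ
  deriving DecidableEq

namespace Basic

/-- Left boundary, from bottom to top. -/
def src (b : Basic) : List ℤ := b.lower ++ b.elem.src ++ b.upper

/-- Right boundary, from bottom to top. -/
def tgt (b : Basic) : List ℤ := b.lower ++ b.elem.tgt ++ b.upper

/-- Reflection of the front in a vertical axis. -/
def mirror (b : Basic) : Basic := ⟨b.lower, b.elem.mirror, b.upper⟩

theorem src_mirror (b : Basic) : b.mirror.src = b.tgt := by
  rcases b with ⟨A, _ | _ | _, B⟩ <;> rfl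

theorem tgt_mirror (b : Basic) : b.mirror.tgt = b.src := by
  rcases b with ⟨A, _ | _ | _, B⟩ <;> rfl

end Basic

/-- `IsPath X w Y`: the basic tangles in the word `w`, read from left to right, have matching ends,
and their horizontal composition has left boundary `X` and right boundary `Y`. -/
def IsPath : List ℤ → List Basic → List ℤ → Prop
  | X, [], Y => X = Y
  | X, b :: w, Y => X = b.src ∧ IsPath b.tgt w Y

theorem isPath_append {X Y Z : List ℤ} {v w : List Basic} (hv : IsPath X v Y)
    (hw : IsPath Y w Z) : IsPath X (v ++ w) Z := by
  induction v generalizing X with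
  | nil => cases hv; exact hw
  | cons b v ih => exact ⟨hv.1, ih hv.2⟩

theorem isPath_mirror {X Y : List ℤ} {w : List Basic} (h : IsPath X w Y) :
    IsPath Y (w.reverse.map Basic.mirror) X := by
  induction w generalizing X with
  | nil => exact Eq.symm h
  | cons b w ih =>
    rw [List.reverse_cons, List.map_append]
    exact isPath_append (ih h.2) ⟨b.src_mirror.symm, by rw [b.tgt_mirror, h.1]; rfl⟩

/-- A (generic) graded Legendrian tangle with left boundary `X` and right boundary `Y`, given by its
front: a horizontal composition of basic tangles. -/
@[ext]
structure Tangle (X Y : List ℤ) : Type where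
  word : List Basic
  isPath : IsPath X word Y

namespace Tangle

/-- The tangle consisting of horizontal strands. -/
def id (X : List ℤ) : Tangle X X := ⟨[], rfl⟩

/-- Horizontal composition, `S` to the left of `T`. -/
def comp {X Y Z : List ℤ} (S : Tangle X Y) (T : Tangle Y Z) : Tangle X Z :=
  ⟨S.word ++ T.word, isPath_append S.isPath T.isPath⟩

/-- Reflection of the front in a vertical axis. -/
def mirror {X Y : List ℤ} (T : Tangle X Y) : Tangle Y X :=
  ⟨T.word.reverse.map Basic.mirror, isPath_mirror T.isPath⟩

end Tangle

/-! ### Legendrian isotopy -/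

/-- The basic moves of fronts, between horizontal strands of degrees `A` below and `B` above. -/
inductive LocalMove : List Basic → List Basic → Prop
  /-- Sliding an elementary tangle `e` past an elementary tangle `f` above it; `M` are the degrees
  of the strands between them. -/
  | slide (A M B : List ℤ) (e f : Elem) :
      LocalMove [⟨A, e, M ++ f.src ++ B⟩, ⟨A ++ e.tgt ++ M, f, B⟩]
        [⟨A ++ e.src ++ M, f, B⟩, ⟨A, e, M ++ f.tgt ++ B⟩]
  /-- First Reidemeister move, left cusp born above the strand. -/
  | reidemeister1_above (A B : List ℤ) (k : ℤ) :
      LocalMove [⟨A ++ [k + 1], .leftCusp k, B⟩, ⟨A, .crossing (k + 1) (k + 1), k :: B⟩,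
        ⟨A ++ [k + 1], .rightCusp k, B⟩] []
  /-- First Reidemeister move, left cusp born below the strand. -/
  | reidemeister1_below (A B : List ℤ) (k : ℤ) :
      LocalMove [⟨A, .leftCusp k, k :: B⟩, ⟨A ++ [k + 1], .crossing k k, B⟩,
        ⟨A, .rightCusp k, k :: B⟩] []
  /-- Second Reidemeister move: a strand of degree `n`, coming from below a left cusp, crosses both
  of its branches. -/
  | reidemeister2_left_above (A B : List ℤ) (k n : ℤ) :
      LocalMove [⟨A ++ [n], .leftCusp k, B⟩, ⟨A, .crossing n (k + 1), k :: B⟩,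
        ⟨A ++ [k + 1], .crossing n k, B⟩] [⟨A, .leftCusp k, n :: B⟩]
  /-- The same with the strand coming from above the left cusp. -/
  | reidemeister2_left_below (A B : List ℤ) (k n : ℤ) :
      LocalMove [⟨A, .leftCusp k, n :: B⟩, ⟨A ++ [k + 1], .crossing k n, B⟩,
        ⟨A, .crossing (k + 1) n, k :: B⟩] [⟨A ++ [n], .leftCusp k, B⟩]
  /-- Second Reidemeister move at a right cusp, the strand ending below the cusp. -/
  | reidemeister2_right_above (A B : List ℤ) (k n : ℤ) :
      LocalMove [⟨A ++ [k + 1], .crossing k n, B⟩, ⟨A, .crossing (k + 1) n, k :: B⟩,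
        ⟨A ++ [n], .rightCusp k, B⟩] [⟨A, .rightCusp k, n :: B⟩]
  /-- Second Reidemeister move at a right cusp, the strand ending above the cusp. -/
  | reidemeister2_right_below (A B : List ℤ) (k n : ℤ) :
      LocalMove [⟨A, .crossing n (k + 1), k :: B⟩, ⟨A ++ [k + 1], .crossing n k, B⟩,
        ⟨A, .rightCusp k, n :: B⟩] [⟨A ++ [n], .rightCusp k, B⟩]
  /-- Third Reidemeister move. -/
  | reidemeister3 (A B : List ℤ) (a b c : ℤ) :
      LocalMove [⟨A, .crossing a b, c :: B⟩, ⟨A ++ [b], .crossing a c, B⟩,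
        ⟨A, .crossing b c, a :: B⟩]
        [⟨A ++ [a], .crossing b c, B⟩, ⟨A, .crossing a c, b :: B⟩, ⟨A ++ [c], .crossing a b, B⟩]

/-- `S` and `T` differ by one basic move in some part of the front. -/
def Tangle.Move {X Y : List ℤ} (S T : Tangle X Y) : Prop :=
  ∃ u l l' v : List Basic, LocalMove l l' ∧ S.word = u ++ l ++ v ∧ T.word = u ++ l' ++ v

/-- Isotopy classes of graded Legendrian tangles from `X` to `Y`: the quotient of the set of fronts
by the equivalence relation generated by the basic moves. -/
def IsotopyClass (X Y : List ℤ) : Type := Quot (Tangle.Move (X := X) (Y := Y))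

/-- The isotopy class of a tangle. -/
def Tangle.isotopyClass {X Y : List ℤ} (T : Tangle X Y) : IsotopyClass X Y := Quot.mk _ T

/-! ### The skein of tangles -/

/-- The isotopy class of `T` as a basis element of the free module. -/
noncomputable def Tangle.free {X Y : List ℤ} (T : Tangle X Y) : IsotopyClass X Y →₀ SkeinRing :=
  Finsupp.single T.isotopyClass 1

/-- The skein relations, `SkeinRel x` meaning that `x = 0` is imposed. In each relation the tangles
agree outside of the displayed part, to the left of which they read `u` and to the right `v`; `A`
and `B` are the degrees of the strands below and above that part.

The relation (S1) for a lower strand of degree `n + 1` and an upper strand of degree `m` is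
`1 - q^((-1)^(m-n)) σσ = δ_{m,n} (q-1) ρλ - δ_{m,n+1} (1-q⁻¹) σ`, and is split
according to which of the terms on the right are present. -/
inductive SkeinRel {X Y : List ℤ} : (IsotopyClass X Y →₀ SkeinRing) → Prop
  /-- (S1), both terms on the right absent. -/
  | s1 (u v : List Basic) (A B : List ℤ) (m n : ℤ) (hmn : m ≠ n) (hmn' : m ≠ n + 1)
      (T₀ T₁ : Tangle X Y)
      (h₀ : T₀.word = u ++ v)
      (h₁ : T₁.word = u ++ [⟨A, .crossing (n + 1) m, B⟩, ⟨A, .crossing m (n + 1), B⟩] ++ v) :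
      SkeinRel (T₀.free - ((q ^ ((m - n).negOnePow : ℤ) : SkeinRingˣ) : SkeinRing) • T₁.free)
  /-- (S1) with `m = n`; then `q^((-1)^(m-n)) = q`. -/
  | s1_cusps (u v : List Basic) (A B : List ℤ) (n : ℤ) (T₀ T₁ T₂ : Tangle X Y)
      (h₀ : T₀.word = u ++ v)
      (h₁ : T₁.word = u ++ [⟨A, .crossing (n + 1) n, B⟩, ⟨A, .crossing n (n + 1), B⟩] ++ v)
      (h₂ : T₂.word = u ++ [⟨A, .rightCusp n, B⟩, ⟨A, .leftCusp n, B⟩] ++ v) :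
      SkeinRel (T₀.free - (q : SkeinRing) • T₁.free - ((q : SkeinRing) - 1) • T₂.free)
  /-- (S1) with `m = n + 1`; then `q^((-1)^(m-n)) = q⁻¹`. -/
  | s1_crossing (u v : List Basic) (A B : List ℤ) (m : ℤ) (T₀ T₁ T₂ : Tangle X Y)
      (h₀ : T₀.word = u ++ v)
      (h₁ : T₁.word = u ++ [⟨A, .crossing m m, B⟩, ⟨A, .crossing m m, B⟩] ++ v)
      (h₂ : T₂.word = u ++ [⟨A, .crossing m m, B⟩] ++ v) :
      SkeinRel (T₀.free - ((q⁻¹ : SkeinRingˣ) : SkeinRing) • T₁.free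
        + (1 - ((q⁻¹ : SkeinRingˣ) : SkeinRing)) • T₂.free)
  /-- (S2): a standard unknot can be removed at the cost of a factor `(q-1)⁻¹`. -/
  | s2 (u v : List Basic) (A B : List ℤ) (n : ℤ) (T₀ T₁ : Tangle X Y)
      (h₀ : T₀.word = u ++ v)
      (h₁ : T₁.word = u ++ [⟨A, .leftCusp n, B⟩, ⟨A, .rightCusp n, B⟩] ++ v) :
      SkeinRel (T₁.free - ((qSubOne⁻¹ : SkeinRingˣ) : SkeinRing) • T₀.free)
  /-- (S3): a tangle with a zigzag (stabilization) vanishes. The strand enters as the upper branch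
  of a right cusp and leaves as the lower branch of a left cusp. -/
  | s3 (u v : List Basic) (A B : List ℤ) (k : ℤ) (T : Tangle X Y)
      (h : T.word = u ++ [⟨A, .leftCusp (k + 1), k :: B⟩, ⟨A ++ [k + 1 + 1], .rightCusp k, B⟩] ++ v) :
      SkeinRel T.free

/-- The skein of graded Legendrian tangles with left boundary `X` and right boundary `Y` (no
boundary skein relations are imposed): the free module on isotopy classes modulo the submodule
generated by the skein relations. -/
abbrev Skein (X Y : List ℤ) : Type :=
  (IsotopyClass X Y →₀ SkeinRing) ⧸
    Submodule.span SkeinRing {x : IsotopyClass X Y →₀ SkeinRing | SkeinRel x}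

/-- The element of the skein represented by a tangle. -/
noncomputable def Tangle.toSkein {X Y : List ℤ} (T : Tangle X Y) : Skein X Y :=
  Submodule.Quotient.mk T.free

/-! ### Strands, cusp tangles and permutation braids -/

namespace Elem

/-- The elementary tangle is a crossing. -/
def IsCrossing : Elem → Prop
  | crossing _ _ => True
  | _ => False

end Elem

namespace Basic

/-- Follow a strand from left to right through a basic tangle: `i` is its height (number of strands
below it) on the left, the result its height on the right, or `none` if it ends in a right cusp. -/
def follow (b : Basic) (i : ℕ) : Option ℕ :=
  let p := b.lower.length
  match b.elem with
  | .crossing _ _ => if i = p then some (p + 1) else if i = p + 1 then some p else some i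
  | .leftCusp _ => if i < p then some i else some (i + 2)
  | .rightCusp _ => if i < p then some i else if i < p + 2 then none else some (i - 2)

/-- The strands at heights `i` and `j` on the left cross each other in the basic tangle. -/
def Crosses (b : Basic) (i j : ℕ) : Prop :=
  b.elem.IsCrossing ∧ ((i = b.lower.length ∧ j = b.lower.length + 1) ∨
    (j = b.lower.length ∧ i = b.lower.length + 1))

end Basic

/-- Follow the strand starting at height `i` of the left boundary through a word, up to the first
right cusp on it. -/
def followWord : List Basic → ℕ → Option ℕ
  | [], i => some i
  | b :: w, i => (b.follow i).bind (followWord w)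

open Classical in
/-- The number of crossings, in a word, between the strands starting at heights `i` and `j` of the
left boundary (each followed up to the first right cusp on it). -/
noncomputable def crossingNumber : List Basic → ℕ → ℕ → ℕ
  | [], _, _ => 0
  | b :: w, i, j => (if b.Crosses i j then 1 else 0) +
      (b.follow i).elim 0 fun i' => (b.follow j).elim 0 fun j' => crossingNumber w i' j'

namespace Tangle

/-- A permutation braid: no cusps, and any pair of strands crosses at most once. -/
def IsPermutationBraid {X Y : List ℤ} (T : Tangle X Y) : Prop :=
  (∀ b ∈ T.word, b.elem.IsCrossing) ∧ ∀ i j, crossingNumber T.word i j ≤ 1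

/-- A right cusp tangle: a single right cusp, no left cusps; the two strands `i`, `j` starting at
the cusp do not cross each other, all crossings involve one of these two strands, and no pair of
strands crosses twice. -/
def IsRightCuspTangle {X Y : List ℤ} (T : Tangle X Y) : Prop :=
  ∃ (u v : List Basic) (A B : List ℤ) (n : ℤ) (i j : ℕ),
    T.word = u ++ [⟨A, .rightCusp n, B⟩] ++ v ∧
    (∀ b ∈ u ++ v, b.elem.IsCrossing) ∧
    followWord u i = some A.length ∧ followWord u j = some (A.length + 1) ∧
    crossingNumber T.word i j = 0 ∧
    (∀ a b, a ≠ i → a ≠ j → b ≠ i → b ≠ j → crossingNumber T.word a b = 0) ∧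
    ∀ a b, crossingNumber T.word a b ≤ 1

/-- A left cusp tangle: the mirror image of a right cusp tangle. -/
def IsLeftCuspTangle {X Y : List ℤ} (T : Tangle X Y) : Prop :=
  T.mirror.IsRightCuspTangle

/-- A horizontal composition of finitely many (possibly zero) right cusp tangles. -/
inductive IsRightCuspSequence : ∀ {X Y : List ℤ}, Tangle X Y → Prop
  | id (X : List ℤ) : IsRightCuspSequence (Tangle.id X)
  | comp {X Y Z : List ℤ} (S : Tangle X Y) (T : Tangle Y Z) :
      S.IsRightCuspTangle → IsRightCuspSequence T → IsRightCuspSequence (S.comp T)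

/-- A horizontal composition of finitely many (possibly zero) left cusp tangles. -/
inductive IsLeftCuspSequence : ∀ {X Y : List ℤ}, Tangle X Y → Prop
  | id (X : List ℤ) : IsLeftCuspSequence (Tangle.id X)
  | comp {X Y Z : List ℤ} (S : Tangle X Y) (T : Tangle Y Z) :
      S.IsLeftCuspTangle → IsLeftCuspSequence T → IsLeftCuspSequence (S.comp T)

/-- From left to right: a sequence of right cusp tangles, a permutation braid, a sequence of left
cusp tangles. -/
def IsNormalForm {X Y : List ℤ} (T : Tangle X Y) : Prop :=
  ∃ (X' Y' : List ℤ) (R : Tangle X X') (P : Tangle X' Y') (L : Tangle Y' Y),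
    R.IsRightCuspSequence ∧ P.IsPermutationBraid ∧ L.IsLeftCuspSequence ∧
      T = (R.comp P).comp L

end Tangle

end LegendrianTangle

namespace LegendrianTangle

/-! ### Words of basic tangles -/

/-! The proof is a rewriting argument on words of basic tangles. `Spn w S` says that `w` lies in the
span of `S` in every context: with letters on both sides, with extra strands above and below, and
after reflection. Such statements may be substituted inside longer words, and each argument at a
left cusp gives its mirror image at a right cusp.

The complexity `mu` counts the ends of all letters, so a letter costs more the more strands run
beside it. Sliding a left cusp to the right past another letter, or a right cusp to the left, lowers
it. `Reduces w S` works modulo words of smaller complexity, so relations are needed only up to lower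
terms: a double crossing disappears, and so does any word in which a letter can be slid to a cheaper
place.

By induction on `mu` (`spn_isStd`) it suffices to put one letter in front of a standard word. A
crossing in front of a permutation braid gives a permutation braid, since a pair of strands that
would cross twice can be uncrossed (`PermWord.reduces_crossing`). A left cusp in front of a
permutation braid becomes one standard left cusp tangle (`PermWord.reduces_leftCusp`). A crossing in
front of a right cusp tangle is absorbed (`reduces_crossing_mir_leftCuspWord`), and a left cusp in
front of a right cusp tangle leaves only lower terms (`reduces_leftCusp_mir_leftCuspWord`). A right
cusp is itself a right cusp tangle.

The geometric inputs are the vanishing of a cusp whose branches cross next to it, and the exchange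
in `reduces_push_leftCusp` of a strand crossing one branch of a cusp for a strand crossing the
other. The relation (S3) is never invoked: zigzags already vanish by (S1), (S2) and isotopy
(`spn_zigzag`). -/

theorem isPath_append_iff {X Z : List ℤ} {v w : List Basic} :
    IsPath X (v ++ w) Z ↔ ∃ Y, IsPath X v Y ∧ IsPath Y w Z := by
  refine ⟨fun h => ?_, fun ⟨Y, hv, hw⟩ => isPath_append hv hw⟩
  induction v generalizing X with
  | nil => exact ⟨X, rfl, h⟩
  | cons b v ih =>
    obtain ⟨Y, hv, hw⟩ := ih h.2
    exact ⟨Y, ⟨h.1, hv⟩, hw⟩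

theorem IsPath.tgt_unique {X Y Y' : List ℤ} {w : List Basic} (h : IsPath X w Y)
    (h' : IsPath X w Y') : Y = Y' := by
  induction w generalizing X with
  | nil => exact h.symm.trans h'
  | cons b w ih => exact ih h.2 h'.2

/-- Add horizontal strands of degrees `A` below and `B` above a word. -/
def whisk (A B : List ℤ) (w : List Basic) : List Basic :=
  w.map fun b => ⟨A ++ b.lower, b.elem, b.upper ++ B⟩

/-- Reflection of a word in a vertical axis. -/
def mir (w : List Basic) : List Basic := w.reverse.map Basic.mirror

@[simp] theorem whisk_nil (A B : List ℤ) : whisk A B [] = [] := rfl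

@[simp] theorem whisk_cons (A B : List ℤ) (b : Basic) (w : List Basic) :
    whisk A B (b :: w) = ⟨A ++ b.lower, b.elem, b.upper ++ B⟩ :: whisk A B w := rfl

@[simp] theorem whisk_append (A B : List ℤ) (v w : List Basic) :
    whisk A B (v ++ w) = whisk A B v ++ whisk A B w := List.map_append

@[simp] theorem length_whisk (A B : List ℤ) (w : List Basic) :
    (whisk A B w).length = w.length := List.length_map ..

@[simp] theorem whisk_whisk (A B C D : List ℤ) (w : List Basic) :
    whisk A B (whisk C D w) = whisk (A ++ C) (D ++ B) w := by
  simp [whisk, List.map_map, Function.comp_def, List.append_assoc]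

@[simp] theorem whisk_nil_nil (w : List Basic) : whisk [] [] w = w := by
  simp [whisk]

@[simp] theorem mir_nil : mir [] = [] := rfl

@[simp] theorem mir_cons (b : Basic) (w : List Basic) : mir (b :: w) = mir w ++ [b.mirror] := by
  simp [mir]

@[simp] theorem mir_append (v w : List Basic) : mir (v ++ w) = mir w ++ mir v := by
  simp [mir]

@[simp] theorem length_mir (w : List Basic) : (mir w).length = w.length := by
  simp [mir]

@[simp] theorem Elem.mirror_mirror (e : Elem) : e.mirror.mirror = e := by cases e <;> rfl

@[simp] theorem Basic.mirror_mirror (b : Basic) : b.mirror.mirror = b := by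
  simp [Basic.mirror]

@[simp] theorem mir_mir (w : List Basic) : mir (mir w) = w := by
  induction w with
  | nil => rfl
  | cons b w ih => simp [ih]

@[simp] theorem mir_whisk (A B : List ℤ) (w : List Basic) :
    mir (whisk A B w) = whisk A B (mir w) := by
  induction w with
  | nil => rfl
  | cons b w ih => simp [ih, Basic.mirror]

theorem isPath_whisk_iff (A B X Y : List ℤ) (w : List Basic) :
    IsPath (A ++ X ++ B) (whisk A B w) (A ++ Y ++ B) ↔ IsPath X w Y := by
  induction w generalizing X with
  | nil => simp [IsPath]
  | cons b w ih =>
    have h1 : (A ++ b.lower ++ b.elem.src ++ (b.upper ++ B)) = A ++ b.src ++ B := by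
      simp [Basic.src]
    have h2 : (A ++ b.lower ++ b.elem.tgt ++ (b.upper ++ B)) = A ++ b.tgt ++ B := by
      simp [Basic.tgt]
    rw [whisk_cons]
    simp only [IsPath]
    rw [← ih]
    simp only [Basic.src, Basic.tgt] at h1 h2 ⊢
    rw [h1, h2]
    simp only [List.append_cancel_left_eq, List.append_cancel_right_eq]

theorem isPath_mir_iff {X Y : List ℤ} {w : List Basic} : IsPath X (mir w) Y ↔ IsPath Y w X :=
  ⟨fun h => by rw [← mir_mir w]; exact isPath_mirror h, fun h => isPath_mirror h⟩

/-- The first letter already records all strands at its left. An empty word records nothing and fits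
anywhere, hence the nonemptiness hypothesis here and in later lemmas. -/
theorem IsPath.whisk_ends {A B X Y Z Z' : List ℤ} {w : List Basic} (hw : IsPath X w Y)
    (hne : w ≠ []) (h : IsPath Z (whisk A B w) Z') : Z = A ++ X ++ B ∧ Z' = A ++ Y ++ B := by
  obtain ⟨b, w, rfl⟩ := List.exists_cons_of_ne_nil hne
  have hZ : Z = A ++ X ++ B := by
    rw [h.1, hw.1]
    simp [Basic.src]
  subst hZ
  exact ⟨rfl, h.tgt_unique ((isPath_whisk_iff A B X Y _).2 hw)⟩

/-! ### Classes of words -/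

open Classical in
/-- The class of a word in the skein, zero if the word is not a tangle from `X` to `Y`. -/
noncomputable def cls (X Y : List ℤ) (w : List Basic) : Skein X Y :=
  if h : IsPath X w Y then Tangle.toSkein ⟨w, h⟩ else 0

theorem cls_of_isPath {X Y : List ℤ} {w : List Basic} (h : IsPath X w Y) :
    cls X Y w = Tangle.toSkein ⟨w, h⟩ := dif_pos h

theorem cls_of_not_isPath {X Y : List ℤ} {w : List Basic} (h : ¬ IsPath X w Y) :
    cls X Y w = 0 := dif_neg h

/-- Reflect a word if `m` is true. -/
def tr (m : Bool) (w : List Basic) : List Basic := if m then mir w else w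

@[simp] theorem tr_true (w : List Basic) : tr true w = mir w := rfl

@[simp] theorem tr_false (w : List Basic) : tr false w = w := rfl

/-- In all contexts, including reflected ones, the class of `w` is in the span of the classes of the
words in `S`. -/
def Spn (w : List Basic) (S : Set (List Basic)) : Prop :=
  ∀ (m : Bool) (A B : List ℤ) (u v : List Basic) (U V : List ℤ),
    cls U V (u ++ whisk A B (tr m w) ++ v) ∈
      Submodule.span SkeinRing ((fun s => cls U V (u ++ whisk A B (tr m s) ++ v)) '' S)

namespace Spn

variable {w : List Basic} {S S' : Set (List Basic)}

theorem of_mem (h : w ∈ S) : Spn w S := fun _ _ _ _ _ _ _ =>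
  Submodule.subset_span ⟨w, h, rfl⟩

theorem trans (h : Spn w S) (h' : ∀ s ∈ S, Spn s S') : Spn w S' := by
  intro m A B u v U V
  refine Submodule.span_le.2 ?_ (h m A B u v U V)
  rintro _ ⟨s, hs, rfl⟩
  exact h' s hs m A B u v U V

theorem mono (h : Spn w S) (hS : S ⊆ S') : Spn w S' := h.trans fun _ hs => of_mem (hS hs)

theorem congr (u v : List Basic) (h : Spn w S) :
    Spn (u ++ w ++ v) ((fun s => u ++ s ++ v) '' S) := by
  intro m A B u' v' U V
  rw [Set.image_image]
  cases m with
  | false =>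
    have := h false A B (u' ++ whisk A B u) (whisk A B v ++ v') U V
    simpa [List.append_assoc] using this
  | true =>
    have := h true A B (u' ++ whisk A B (mir v)) (whisk A B (mir u) ++ v') U V
    simpa [List.append_assoc] using this

theorem whisk (A B : List ℤ) (h : Spn w S) :
    Spn (whisk A B w) (LegendrianTangle.whisk A B '' S) := by
  intro m A' B' u' v' U V
  rw [Set.image_image]
  have := h m (A' ++ A) (B ++ B') u' v' U V
  cases m <;> simpa using this

theorem mir (h : Spn w S) : Spn (mir w) (LegendrianTangle.mir '' S) := by
  intro m A' B' u' v' U V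
  rw [Set.image_image]
  have := h (!m) A' B' u' v' U V
  cases m <;> simpa using this

/-- Only words with the correct ends matter. -/
theorem filter {X Y : List ℤ} (hw : IsPath X w Y) (hne : w ≠ []) (h : Spn w S) :
    Spn w {s ∈ S | IsPath X s Y} := by
  intro m A B u v U V
  by_cases hp : IsPath U (u ++ LegendrianTangle.whisk A B (tr m w) ++ v) V
  · refine Submodule.span_le.2 ?_ (h m A B u v U V)
    rintro _ ⟨s, hs, rfl⟩
    by_cases hs' : IsPath U (u ++ LegendrianTangle.whisk A B (tr m s) ++ v) V
    · refine Submodule.subset_span ⟨s, ⟨hs, ?_⟩, rfl⟩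
      obtain ⟨Y₁, h₁, h₂⟩ := isPath_append_iff.1 hp
      obtain ⟨X₁, h₃, h₄⟩ := isPath_append_iff.1 h₁
      obtain ⟨Y₂, h₁', h₂'⟩ := isPath_append_iff.1 hs'
      obtain ⟨X₂, h₃', h₄'⟩ := isPath_append_iff.1 h₁'
      -- The letters outside the middle piece determine its ends, so a replacement that still gives
      -- a tangle has the same ends as the original. All other replacements contribute zero.
      cases h₃.tgt_unique h₃'
      cases (isPath_mir_iff.2 h₂').tgt_unique (isPath_mir_iff.2 h₂)
      cases m with
      | false =>
        obtain ⟨rfl, rfl⟩ := hw.whisk_ends hne h₄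
        exact (isPath_whisk_iff ..).1 h₄'
      | true =>
        obtain ⟨rfl, rfl⟩ := (isPath_mir_iff.2 hw).whisk_ends
          (by rwa [Ne, ← List.length_eq_zero_iff, length_mir, List.length_eq_zero_iff]) h₄
        exact isPath_mir_iff.1 ((isPath_whisk_iff ..).1 h₄')
    · dsimp only
      rw [cls_of_not_isPath hs']
      exact zero_mem _
  · rw [cls_of_not_isPath hp]; exact zero_mem _

end Spn

/-! ### Moves and skein relations between words -/

theorem LocalMove.whisk {l l' : List Basic} (A B : List ℤ) (h : LocalMove l l') :
    LocalMove (whisk A B l) (whisk A B l') := by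
  cases h with
  | slide A' M B' e f => simpa using LocalMove.slide (A ++ A') M (B' ++ B) e f
  | reidemeister1_above A' B' k =>
    simpa using LocalMove.reidemeister1_above (A ++ A') (B' ++ B) k
  | reidemeister1_below A' B' k =>
    simpa using LocalMove.reidemeister1_below (A ++ A') (B' ++ B) k
  | reidemeister2_left_above A' B' k n =>
    simpa using LocalMove.reidemeister2_left_above (A ++ A') (B' ++ B) k n
  | reidemeister2_left_below A' B' k n =>
    simpa using LocalMove.reidemeister2_left_below (A ++ A') (B' ++ B) k n
  | reidemeister2_right_above A' B' k n =>
    simpa using LocalMove.reidemeister2_right_above (A ++ A') (B' ++ B) k n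
  | reidemeister2_right_below A' B' k n =>
    simpa using LocalMove.reidemeister2_right_below (A ++ A') (B' ++ B) k n
  | reidemeister3 A' B' a b c =>
    simpa using LocalMove.reidemeister3 (A ++ A') (B' ++ B) a b c

theorem LocalMove.isPath {l l' : List Basic} {X Y : List ℤ} (h : LocalMove l l')
    (hl : IsPath X l Y) : IsPath X l' Y := by
  cases h <;> simp [IsPath, Basic.src, Basic.tgt, Elem.src, Elem.tgt] at hl ⊢ <;> simp_all

/-- Run backwards from the empty word, a first Reidemeister move could be applied where no strand of
the right degree is present. The hypothesis excludes this. -/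
theorem LocalMove.isPath_symm {l l' : List Basic} {X Y : List ℤ} (h : LocalMove l l')
    (hne : l' ≠ []) (hl : IsPath X l' Y) : IsPath X l Y := by
  cases h <;> simp [IsPath, Basic.src, Basic.tgt, Elem.src, Elem.tgt] at hne hl ⊢ <;> simp_all

/-- A basic move in either direction, the starting word being nonempty. -/
def Mv (l l' : List Basic) : Prop := LocalMove l l' ∨ (LocalMove l' l ∧ l ≠ [])

theorem Elem.src_mirror (e : Elem) : e.mirror.src = e.tgt := by cases e <;> rfl

theorem Elem.tgt_mirror (e : Elem) : e.mirror.tgt = e.src := by cases e <;> rfl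

namespace Mv

theorem isPath {l l' : List Basic} {X Y : List ℤ} (h : Mv l l') (hl : IsPath X l Y) :
    IsPath X l' Y :=
  h.elim (fun h => h.isPath hl) fun h => h.1.isPath_symm h.2 hl

theorem whisk {l l' : List Basic} (A B : List ℤ) (h : Mv l l') :
    Mv (whisk A B l) (LegendrianTangle.whisk A B l') :=
  h.imp (LocalMove.whisk A B) fun h => ⟨h.1.whisk A B, by simpa [LegendrianTangle.whisk] using h.2⟩

theorem mir {l l' : List Basic} (h : Mv l l') : Mv (mir l) (LegendrianTangle.mir l') := by
  have key : ∀ {l l' : List Basic}, LocalMove l l' →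
      LocalMove (LegendrianTangle.mir l) (LegendrianTangle.mir l') ∨
      (LocalMove (LegendrianTangle.mir l') (LegendrianTangle.mir l) ∧ l ≠ [] ∧ l' ≠ []) := by
    intro l l' h
    cases h with
    | slide A M B e f =>
      -- Reflection exchanges the two sides of a slide, so it becomes a slide in the opposite
      -- direction. Every other move goes to a move in the same direction.
      right
      refine ⟨?_, by simp, by simp⟩
      have := LocalMove.slide A M B e.mirror f.mirror
      simpa [Basic.mirror, Elem.src_mirror, Elem.tgt_mirror] using this
    | reidemeister1_above A B k => exact .inl (.reidemeister1_above A B k)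
    | reidemeister1_below A B k => exact .inl (.reidemeister1_below A B k)
    | reidemeister2_left_above A B k n => exact .inl (.reidemeister2_right_above A B k n)
    | reidemeister2_left_below A B k n => exact .inl (.reidemeister2_right_below A B k n)
    | reidemeister2_right_above A B k n => exact .inl (.reidemeister2_left_above A B k n)
    | reidemeister2_right_below A B k n => exact .inl (.reidemeister2_left_below A B k n)
    | reidemeister3 A B a b c => exact .inl (.reidemeister3 A B c b a)
  have hne : ∀ {l : List Basic}, l ≠ [] → LegendrianTangle.mir l ≠ [] := fun h => by
    simpa [LegendrianTangle.mir] using h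
  rcases h with h | ⟨h, hl⟩
  · rcases key h with h | ⟨h, h₁, h₂⟩
    · exact .inl h
    · exact .inr ⟨h, hne h₁⟩
  · rcases key h with h | ⟨h, h₁, h₂⟩
    · exact .inr ⟨h, hne hl⟩
    · exact .inl h

theorem cls_eq {l l' : List Basic} {U V : List ℤ} {u v : List Basic} (h : Mv l l')
    (hp : IsPath U (u ++ l ++ v) V) : cls U V (u ++ l ++ v) = cls U V (u ++ l' ++ v) := by
  have hp' : IsPath U (u ++ l' ++ v) V := by
    obtain ⟨Y₁, h₁, h₂⟩ := isPath_append_iff.1 hp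
    obtain ⟨X₁, h₃, h₄⟩ := isPath_append_iff.1 h₁
    exact isPath_append (isPath_append h₃ (h.isPath h₄)) h₂
  rw [cls_of_isPath hp, cls_of_isPath hp']
  have : (⟨_, hp⟩ : Tangle U V).isotopyClass = (⟨_, hp'⟩ : Tangle U V).isotopyClass := by
    rcases h with h | ⟨h, -⟩
    · exact Quot.sound ⟨u, l, l', v, h, rfl, rfl⟩
    · exact (Quot.sound ⟨u, l', l, v, h, rfl, rfl⟩ : Quot.mk _ _ = Quot.mk _ _).symm
  simp only [Tangle.toSkein, Tangle.free, this]

theorem spn {l l' : List Basic} (h : Mv l l') : Spn l {l'} := by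
  intro m A B u v U V
  have hm : Mv (LegendrianTangle.whisk A B (tr m l)) (LegendrianTangle.whisk A B (tr m l')) := by
    cases m
    · exact h.whisk A B
    · exact h.mir.whisk A B
  by_cases hp : IsPath U (u ++ LegendrianTangle.whisk A B (tr m l) ++ v) V
  · rw [hm.cls_eq hp]
    exact Submodule.subset_span ⟨l', rfl, rfl⟩
  · rw [cls_of_not_isPath hp]; exact zero_mem _

end Mv

theorem LocalMove.mv {l l' : List Basic} (h : LocalMove l l') : Mv l l' := .inl h

theorem LocalMove.mv_symm {l l' : List Basic} (h : LocalMove l l') (hl : l' ≠ []) : Mv l' l :=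
  .inr ⟨h, hl⟩

/-! ### Skein relations as identities between classes of words -/

theorem mk_eq_zero_of_skeinRel {X Y : List ℤ} {x : IsotopyClass X Y →₀ SkeinRing}
    (h : SkeinRel x) : (Submodule.Quotient.mk x : Skein X Y) = 0 :=
  (Submodule.Quotient.mk_eq_zero _).2 (Submodule.subset_span h)

theorem units_smul_eq {M : Type*} [AddCommGroup M] [Module SkeinRing M] (c : SkeinRingˣ) {x y : M}
    (h : x = (c : SkeinRing) • y) : y = ((c⁻¹ : SkeinRingˣ) : SkeinRing) • x := by
  rw [h, smul_smul, Units.inv_mul, one_smul]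

theorem cls_cusps {U V : List ℤ} (u v : List Basic) (A B : List ℤ) (n : ℤ)
    (h : IsPath U (u ++ [⟨A, .crossing (n + 1) n, B⟩, ⟨A, .crossing n (n + 1), B⟩] ++ v) V) :
    cls U V (u ++ v) = (q : SkeinRing) •
        cls U V (u ++ [⟨A, .crossing (n + 1) n, B⟩, ⟨A, .crossing n (n + 1), B⟩] ++ v) +
      (qSubOne : SkeinRing) • cls U V (u ++ [⟨A, .rightCusp n, B⟩, ⟨A, .leftCusp n, B⟩] ++ v) := by
  obtain ⟨Y₁, h₁, h₂⟩ := isPath_append_iff.1 h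
  obtain ⟨X₁, h₃, h₄⟩ := isPath_append_iff.1 h₁
  have e : X₁ = Y₁ := h₄.1.trans h₄.2.2
  subst e
  have h₅ : IsPath U (u ++ v) V := isPath_append h₃ h₂
  have h₆ : IsPath U (u ++ [⟨A, .rightCusp n, B⟩, ⟨A, .leftCusp n, B⟩] ++ v) V :=
    isPath_append (isPath_append h₃ ⟨h₄.1, rfl, h₄.2.2⟩) h₂
  have := mk_eq_zero_of_skeinRel
    (SkeinRel.s1_cusps u v A B n ⟨_, h₅⟩ ⟨_, h⟩ ⟨_, h₆⟩ rfl rfl rfl)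
  rw [Submodule.Quotient.mk_sub, Submodule.Quotient.mk_sub, Submodule.Quotient.mk_smul,
    Submodule.Quotient.mk_smul] at this
  rw [cls_of_isPath h, cls_of_isPath h₅, cls_of_isPath h₆, coe_qSubOne]
  exact (sub_eq_iff_eq_add.1 (sub_eq_zero.1 this)).trans (add_comm _ _)

theorem cls_crossings {U V : List ℤ} (u v : List Basic) (A B : List ℤ) (n : ℤ)
    (h : IsPath U (u ++ [⟨A, .crossing n n, B⟩, ⟨A, .crossing n n, B⟩] ++ v) V) :
    cls U V (u ++ v) = ((q⁻¹ : SkeinRingˣ) : SkeinRing) •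
        cls U V (u ++ [⟨A, .crossing n n, B⟩, ⟨A, .crossing n n, B⟩] ++ v) -
      (1 - ((q⁻¹ : SkeinRingˣ) : SkeinRing)) • cls U V (u ++ [⟨A, .crossing n n, B⟩] ++ v) := by
  obtain ⟨Y₁, h₁, h₂⟩ := isPath_append_iff.1 h
  obtain ⟨X₁, h₃, h₄⟩ := isPath_append_iff.1 h₁
  have e : X₁ = Y₁ := h₄.1.trans h₄.2.2
  subst e
  have h₅ : IsPath U (u ++ v) V := isPath_append h₃ h₂
  have h₆ : IsPath U (u ++ [⟨A, .crossing n n, B⟩] ++ v) V :=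
    isPath_append (isPath_append h₃ ⟨h₄.1, h₄.2.2⟩) h₂
  have := mk_eq_zero_of_skeinRel
    (SkeinRel.s1_crossing u v A B n ⟨_, h₅⟩ ⟨_, h⟩ ⟨_, h₆⟩ rfl rfl rfl)
  rw [Submodule.Quotient.mk_add, Submodule.Quotient.mk_sub, Submodule.Quotient.mk_smul,
    Submodule.Quotient.mk_smul] at this
  rw [cls_of_isPath h, cls_of_isPath h₅, cls_of_isPath h₆, eq_sub_iff_add_eq, ← sub_eq_zero,
    ← this]
  simp only [Tangle.toSkein]
  abel

theorem cls_generic {U V : List ℤ} (u v : List Basic) (A B : List ℤ) (n m : ℤ) (hmn : m ≠ n)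
    (hmn' : m ≠ n + 1)
    (h : IsPath U (u ++ [⟨A, .crossing (n + 1) m, B⟩, ⟨A, .crossing m (n + 1), B⟩] ++ v) V) :
    cls U V (u ++ v) = ((q ^ ((m - n).negOnePow : ℤ) : SkeinRingˣ) : SkeinRing) •
      cls U V (u ++ [⟨A, .crossing (n + 1) m, B⟩, ⟨A, .crossing m (n + 1), B⟩] ++ v) := by
  obtain ⟨Y₁, h₁, h₂⟩ := isPath_append_iff.1 h
  obtain ⟨X₁, h₃, h₄⟩ := isPath_append_iff.1 h₁
  have e : X₁ = Y₁ := h₄.1.trans h₄.2.2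
  subst e
  have h₅ : IsPath U (u ++ v) V := isPath_append h₃ h₂
  have := mk_eq_zero_of_skeinRel
    (SkeinRel.s1 u v A B m n hmn hmn' ⟨_, h₅⟩ ⟨_, h⟩ rfl rfl)
  rw [Submodule.Quotient.mk_sub, Submodule.Quotient.mk_smul] at this
  rw [cls_of_isPath h, cls_of_isPath h₅]
  exact sub_eq_zero.1 this

theorem cls_unknot {U V : List ℤ} (u v : List Basic) (A B : List ℤ) (n : ℤ)
    (h : IsPath U (u ++ [⟨A, .leftCusp n, B⟩, ⟨A, .rightCusp n, B⟩] ++ v) V) :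
    cls U V (u ++ [⟨A, .leftCusp n, B⟩, ⟨A, .rightCusp n, B⟩] ++ v) =
      ((qSubOne⁻¹ : SkeinRingˣ) : SkeinRing) • cls U V (u ++ v) := by
  obtain ⟨Y₁, h₁, h₂⟩ := isPath_append_iff.1 h
  obtain ⟨X₁, h₃, h₄⟩ := isPath_append_iff.1 h₁
  have e : X₁ = Y₁ := h₄.1.trans h₄.2.2
  subst e
  have h₅ : IsPath U (u ++ v) V := isPath_append h₃ h₂
  have := mk_eq_zero_of_skeinRel (SkeinRel.s2 u v A B n ⟨_, h₅⟩ ⟨_, h⟩ rfl rfl)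
  rw [Submodule.Quotient.mk_sub, Submodule.Quotient.mk_smul] at this
  rw [cls_of_isPath h, cls_of_isPath h₅]
  exact sub_eq_zero.1 this

/-- Undo two crossings between the same strands. -/
theorem spn_double_crossing (A B : List ℤ) (a b : ℤ) :
    Spn [⟨A, .crossing a b, B⟩, ⟨A, .crossing b a, B⟩]
      {[], [⟨A, .crossing a b, B⟩], [⟨A, .rightCusp b, B⟩, ⟨A, .leftCusp b, B⟩]} := by
  intro m A' B' u v U V
  -- The double crossing and the pair right cusp, left cusp are their own mirror images, so a
  -- reflected context needs no separate argument.
  have e : ∀ w, (w = [⟨A, .crossing a b, B⟩, ⟨A, .crossing b a, B⟩] ∨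
      w = [⟨A, .rightCusp b, B⟩, ⟨A, .leftCusp b, B⟩]) → tr m w = w := by
    rintro _ (rfl | rfl) <;> cases m <;> rfl
  rw [Set.image_insert_eq, Set.image_insert_eq, Set.image_singleton, e _ (.inl rfl),
    e _ (.inr rfl)]
  have e' : tr m [] = [] := by cases m <;> rfl
  rw [e', whisk_nil, List.append_nil]
  by_cases h : IsPath U (u ++ whisk A' B' [⟨A, .crossing a b, B⟩, ⟨A, .crossing b a, B⟩] ++ v) V
  swap
  · rw [cls_of_not_isPath h]; exact zero_mem _
  -- (S1) is indexed by a lower strand of degree `n + 1`. In each of its cases the coefficient of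
  -- the double crossing is a power of `q`, hence invertible, and the relation can be solved for
  -- that term.
  obtain ⟨n, rfl⟩ : ∃ n, a = n + 1 := ⟨a - 1, by ring⟩
  by_cases h₁ : b = n
  · subst h₁
    have := cls_cusps u v (A' ++ A) (B ++ B') b h
    have h₂ := units_smul_eq q (sub_eq_iff_eq_add.2 this)
    simp only [whisk_cons, whisk_nil]
    rw [h₂]
    refine Submodule.smul_mem _ _ (Submodule.sub_mem _ ?_ (Submodule.smul_mem _ _ ?_)) <;>
      exact Submodule.subset_span (by simp)
  by_cases h₁' : b = n + 1
  · subst h₁'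
    have := cls_crossings u v (A' ++ A) (B ++ B') (n + 1) h
    have h₂ := units_smul_eq q⁻¹ (eq_sub_iff_add_eq.1 this)
    have e'' : tr m [⟨A, .crossing (n + 1) (n + 1), B⟩] = [⟨A, .crossing (n + 1) (n + 1), B⟩] := by
      cases m <;> rfl
    rw [e'']
    simp only [whisk_cons, whisk_nil]
    rw [h₂]
    refine Submodule.smul_mem _ _ (Submodule.add_mem _ ?_ (Submodule.smul_mem _ _ ?_)) <;>
      exact Submodule.subset_span (by simp)
  · have := units_smul_eq _ (cls_generic u v (A' ++ A) (B ++ B') n b h₁ h₁' h)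
    simp only [whisk_cons, whisk_nil]
    rw [this]
    exact Submodule.smul_mem _ _ (Submodule.subset_span (by simp))

/-- This is (S1) read in the other direction, solved for the uncrossed strands. The two kinds of
correction term occur only for the stated coincidences of degrees. -/
theorem cls_mem_of_crossings {U V : List ℤ} {u v : List Basic} {A B : List ℤ} {a b : ℤ}
    (hu : IsPath U u (A ++ [a, b] ++ B)) (hv : IsPath (A ++ [a, b] ++ B) v V)
    {N : Submodule SkeinRing (Skein U V)}
    (h₁ : cls U V (u ++ [⟨A, .crossing a b, B⟩, ⟨A, .crossing b a, B⟩] ++ v) ∈ N)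
    (h₂ : a = b → cls U V (u ++ [⟨A, .crossing a b, B⟩] ++ v) ∈ N)
    (h₃ : a = b + 1 → cls U V (u ++ [⟨A, .rightCusp b, B⟩, ⟨A, .leftCusp b, B⟩] ++ v) ∈ N) :
    cls U V (u ++ v) ∈ N := by
  have h : IsPath U (u ++ [⟨A, .crossing a b, B⟩, ⟨A, .crossing b a, B⟩] ++ v) V :=
    isPath_append (isPath_append hu ⟨rfl, rfl, rfl⟩) hv
  obtain ⟨n, rfl⟩ : ∃ n, a = n + 1 := ⟨a - 1, by ring⟩
  by_cases hb : b = n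
  · subst hb
    rw [cls_cusps u v A B b h]
    exact Submodule.add_mem _ (Submodule.smul_mem _ _ h₁) (Submodule.smul_mem _ _ (h₃ rfl))
  by_cases hb' : b = n + 1
  · subst hb'
    rw [cls_crossings u v A B (n + 1) h]
    exact Submodule.sub_mem _ (Submodule.smul_mem _ _ h₁) (Submodule.smul_mem _ _ (h₂ rfl))
  · rw [cls_generic u v A B n b hb hb' h]
    exact Submodule.smul_mem _ _ h₁

/-- Create two crossings between adjacent strands. -/
theorem spn_create_crossings {A B : List ℤ} {a b : ℤ} {u v : List Basic} {X Y : List ℤ}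
    (hu : IsPath X u (A ++ [a, b] ++ B)) (hv : IsPath (A ++ [a, b] ++ B) v Y) (hne : u ++ v ≠ []) :
    Spn (u ++ v) {w | w = u ++ [⟨A, .crossing a b, B⟩, ⟨A, .crossing b a, B⟩] ++ v ∨
      (a = b ∧ w = u ++ [⟨A, .crossing a b, B⟩] ++ v) ∨
      (a = b + 1 ∧ w = u ++ [⟨A, .rightCusp b, B⟩, ⟨A, .leftCusp b, B⟩] ++ v)} := by
  intro m A' B' u' v' U V
  by_cases hp : IsPath U (u' ++ whisk A' B' (tr m (u ++ v)) ++ v') V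
  swap
  · rw [cls_of_not_isPath hp]; exact zero_mem _
  obtain ⟨Y₁, h₁, h₂⟩ := isPath_append_iff.1 hp
  obtain ⟨X₁, h₃, h₄⟩ := isPath_append_iff.1 h₁
  have e : A' ++ (A ++ [a, b] ++ B) ++ B' = A' ++ A ++ [a, b] ++ (B ++ B') := by simp
  cases m with
  | false =>
    obtain ⟨rfl, rfl⟩ := (isPath_append hu hv).whisk_ends hne h₄
    have hl := isPath_append h₃ ((isPath_whisk_iff A' B' _ _ _).2 hu)
    have hr := isPath_append ((isPath_whisk_iff A' B' _ _ _).2 hv) h₂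
    rw [e] at hl hr
    have e₁ : ∀ w, u' ++ whisk A' B' (tr false (u ++ w ++ v)) ++ v' =
        (u' ++ whisk A' B' u) ++ whisk A' B' w ++ (whisk A' B' v ++ v') := by simp
    have e₂ := e₁ []
    simp only [List.append_nil, whisk_nil] at e₂
    rw [e₂]
    refine cls_mem_of_crossings hl hr ?_ (fun hab => ?_) (fun hab => ?_)
    · exact Submodule.subset_span ⟨_, .inl rfl, by simp only [e₁]; simp⟩
    · exact Submodule.subset_span ⟨_, .inr (.inl ⟨hab, rfl⟩), by simp only [e₁]; simp⟩
    · exact Submodule.subset_span ⟨_, .inr (.inr ⟨hab, rfl⟩), by simp only [e₁]; simp⟩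
  | true =>
    obtain ⟨rfl, rfl⟩ := (isPath_mir_iff.2 (isPath_append hu hv)).whisk_ends
      (by rwa [Ne, ← List.length_eq_zero_iff, length_mir, List.length_eq_zero_iff]) h₄
    have hl := isPath_append h₃ ((isPath_whisk_iff A' B' _ _ _).2 (isPath_mir_iff.2 hv))
    have hr := isPath_append ((isPath_whisk_iff A' B' _ _ _).2 (isPath_mir_iff.2 hu)) h₂
    rw [e] at hl hr
    have e₁ : ∀ w, u' ++ whisk A' B' (tr true (u ++ w ++ v)) ++ v' =
        (u' ++ whisk A' B' (mir v)) ++ whisk A' B' (mir w) ++ (whisk A' B' (mir u) ++ v') := by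
      simp
    have e₂ := e₁ []
    simp only [List.append_nil, mir_nil, whisk_nil] at e₂
    rw [e₂]
    refine cls_mem_of_crossings hl hr ?_ (fun hab => ?_) (fun hab => ?_)
    · exact Submodule.subset_span ⟨_, .inl rfl, by
        simp only [e₁]; simp [Basic.mirror, Elem.mirror]⟩
    · subst hab
      exact Submodule.subset_span ⟨_, .inr (.inl ⟨rfl, rfl⟩), by
        simp only [e₁]; simp [Basic.mirror, Elem.mirror]⟩
    · exact Submodule.subset_span ⟨_, .inr (.inr ⟨hab, rfl⟩), by
        simp only [e₁]; simp [Basic.mirror, Elem.mirror]⟩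

theorem spn_unknot (A B : List ℤ) (n : ℤ) :
    Spn [⟨A, .leftCusp n, B⟩, ⟨A, .rightCusp n, B⟩] {[]} := by
  intro m A' B' u v U V
  have e : tr m [⟨A, .leftCusp n, B⟩, ⟨A, .rightCusp n, B⟩] =
      [⟨A, .leftCusp n, B⟩, ⟨A, .rightCusp n, B⟩] := by cases m <;> rfl
  have e' : tr m [] = [] := by cases m <;> rfl
  rw [Set.image_singleton, e, e', whisk_nil, List.append_nil]
  by_cases h : IsPath U (u ++ whisk A' B' [⟨A, .leftCusp n, B⟩, ⟨A, .rightCusp n, B⟩] ++ v) V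
  swap
  · rw [cls_of_not_isPath h]; exact zero_mem _
  simp only [whisk_cons, whisk_nil] at h ⊢
  rw [cls_unknot u v _ _ n h]
  exact Submodule.smul_mem _ _ (Submodule.subset_span rfl)

/-! ### Vanishing of crossed cusps and zigzags -/

theorem smul_qSubOne_cls {U V : List ℤ} {u v : List Basic} {A B : List ℤ} {n : ℤ}
    (h : IsPath U (u ++ [⟨A, .leftCusp n, B⟩, ⟨A, .rightCusp n, B⟩] ++ v) V) :
    (qSubOne : SkeinRing) • cls U V (u ++ [⟨A, .leftCusp n, B⟩, ⟨A, .rightCusp n, B⟩] ++ v) =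
      cls U V (u ++ v) := by
  rw [cls_unknot u v A B n h, smul_smul, Units.mul_inv, one_smul]

/-- A full twist of the two branches of a cusp vanishes. -/
theorem spn_twisted_cusp (A B : List ℤ) (n : ℤ) :
    Spn [⟨A, .crossing (n + 1) n, B⟩, ⟨A, .crossing n (n + 1), B⟩, ⟨A, .rightCusp n, B⟩] ∅ := by
  intro m A' B' u v U V
  rw [Set.image_empty, Submodule.span_empty, Submodule.mem_bot]
  by_cases hp : IsPath U (u ++ whisk A' B' (tr m [⟨A, .crossing (n + 1) n, B⟩,
    ⟨A, .crossing n (n + 1), B⟩, ⟨A, .rightCusp n, B⟩]) ++ v) V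
  swap
  · exact cls_of_not_isPath hp
  obtain ⟨Y₁, h₁, h₂⟩ := isPath_append_iff.1 hp
  obtain ⟨X₁, h₃, h₄⟩ := isPath_append_iff.1 h₁
  -- Here `y` is the cusp and `x` the twisted cusp. (S1) next to the cusp produces a term with
  -- coefficient `q - 1` containing an unknot, which (S2) turns into `y` itself. The two copies of
  -- `y` cancel, and `q` is invertible.
  have key : ∀ {x y : Skein U V}, y = (q : SkeinRing) • x + y → x = 0 := by
    intro x y h
    have h' : (q : SkeinRing) • x = 0 := by simpa using h
    have := units_smul_eq q h'.symm
    rwa [smul_zero] at this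
  cases m with
  | false =>
    simp only [tr_false, whisk_cons, whisk_nil] at h₄ hp ⊢
    have hr : IsPath X₁ [⟨A' ++ A, .rightCusp n, B ++ B'⟩] Y₁ := ⟨h₄.1, h₄.2.2.2⟩
    have c₁ := cls_cusps u ([⟨A' ++ A, .rightCusp n, B ++ B'⟩] ++ v) (A' ++ A) (B ++ B') n
      (by simpa using hp)
    have c₂ := smul_qSubOne_cls (u := u ++ [⟨A' ++ A, .rightCusp n, B ++ B'⟩]) (v := v)
      (A := A' ++ A) (B := B ++ B') (n := n) (isPath_append (isPath_append
        (isPath_append h₃ hr) ⟨hr.2.symm, rfl, hr.2⟩) h₂)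
    simp only [List.append_assoc, List.cons_append, List.nil_append] at c₁ c₂ ⊢
    rw [c₂] at c₁
    exact key c₁
  | true =>
    simp only [tr_true, mir_cons, mir_nil, whisk_cons, whisk_nil, List.nil_append,
      List.cons_append, Basic.mirror, Elem.mirror] at h₄ hp ⊢
    have hl : IsPath X₁ [⟨A' ++ A, .leftCusp n, B ++ B'⟩] Y₁ := ⟨h₄.1, h₄.2.2.2⟩
    have c₁ := cls_cusps (u ++ [⟨A' ++ A, .leftCusp n, B ++ B'⟩]) v (A' ++ A) (B ++ B') n
      (by simpa using hp)
    have c₂ := smul_qSubOne_cls (u := u) (v := [⟨A' ++ A, .leftCusp n, B ++ B'⟩] ++ v)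
      (A := A' ++ A) (B := B ++ B') (n := n) (isPath_append (isPath_append h₃
        ⟨hl.1, rfl, hl.1.symm⟩) (isPath_append hl h₂))
    simp only [List.append_assoc, List.cons_append, List.nil_append] at c₁ c₂ ⊢
    rw [c₂] at c₁
    exact key c₁

/-- A right cusp vanishes if its branches cross directly to the left of it. -/
theorem spn_crossed_rightCusp (A B : List ℤ) (n : ℤ) :
    Spn [⟨A, .crossing n (n + 1), B⟩, ⟨A, .rightCusp n, B⟩] ∅ := by
  -- With degree `n` below `n + 1` neither correction term of (S1) is possible, so inserting a
  -- double crossing only multiplies by a unit. The result contains a full twist next to the cusp.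
  have h := spn_create_crossings (A := A) (B := B) (a := n) (b := n + 1) (u := [])
    (v := [⟨A, .crossing n (n + 1), B⟩, ⟨A, .rightCusp n, B⟩]) rfl ⟨rfl, rfl, rfl⟩ (by simp)
  refine h.trans ?_
  rintro s (rfl | ⟨h, -⟩ | ⟨h, -⟩)
  · have := (spn_twisted_cusp A B n).congr [⟨A, .crossing n (n + 1), B⟩] []
    simpa using this
  · omega
  · omega

theorem spn_crossed_leftCusp (A B : List ℤ) (n : ℤ) :
    Spn [⟨A, .leftCusp n, B⟩, ⟨A, .crossing (n + 1) n, B⟩] ∅ := by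
  simpa [Basic.mirror, Elem.mirror] using (spn_crossed_rightCusp A B n).mir

/-- Zigzags vanish. -/
theorem spn_zigzag (A B : List ℤ) (k : ℤ) :
    Spn [⟨A, .leftCusp (k + 1), k :: B⟩, ⟨A ++ [k + 1 + 1], .rightCusp k, B⟩] ∅ := by
  -- The strand of degree `k` is pulled through the left cusp by a second Reidemeister move. Its
  -- crossing with the upper branch then lies directly before the right cusp joining these two
  -- strands, and a crossed right cusp vanishes.
  have h := (LocalMove.reidemeister2_left_above A B (k + 1) k).mv_symm (by simp)
  refine (h.spn.congr [] [⟨A ++ [k + 1 + 1], .rightCusp k, B⟩]).trans ?_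
  rintro _ ⟨s, rfl, rfl⟩
  have := (spn_crossed_rightCusp (A ++ [k + 1 + 1]) B k).congr
    [⟨A ++ [k], .leftCusp (k + 1), B⟩, ⟨A, .crossing k (k + 1 + 1), (k + 1) :: B⟩] []
  simpa using this

theorem spn_zigzag' (A B : List ℤ) (k : ℤ) :
    Spn [⟨A ++ [k + 1 + 1], .leftCusp k, B⟩, ⟨A, .rightCusp (k + 1), k :: B⟩] ∅ := by
  simpa [Basic.mirror, Elem.mirror] using (spn_zigzag A B k).mir

/-! ### Complexity of words -/

/-- The number of ends of a basic tangle. -/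
def Basic.weight (b : Basic) : ℕ := b.src.length + b.tgt.length

/-- The complexity of a word: the total number of ends of its letters. -/
def mu (w : List Basic) : ℕ := (w.map Basic.weight).sum

@[simp] theorem mu_nil : mu [] = 0 := rfl

@[simp] theorem mu_cons (b : Basic) (w : List Basic) : mu (b :: w) = b.weight + mu w := by
  simp [mu]

@[simp] theorem mu_append (v w : List Basic) : mu (v ++ w) = mu v + mu w := by
  simp [mu]

@[simp] theorem mu_mir (w : List Basic) : mu (mir w) = mu w := by
  induction w with
  | nil => rfl
  | cons b w ih =>
    simp [ih, Basic.weight, Basic.src_mirror, Basic.tgt_mirror]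
    ring

/-- Extra strands raise the complexity in proportion to the number of letters. This is why `Le` and
`Lt` also bound the length: otherwise they would not survive adding strands. -/
theorem mu_whisk (A B : List ℤ) (w : List Basic) :
    mu (whisk A B w) = mu w + 2 * (A.length + B.length) * w.length := by
  induction w with
  | nil => rfl
  | cons b w ih =>
    simp [ih, Basic.weight, Basic.src, Basic.tgt]
    ring

/-- `v` is at most as complex as `w`. -/
def Le (v w : List Basic) : Prop := v.length ≤ w.length ∧ mu v ≤ mu w

/-- `v` is less complex than `w`. -/
def Lt (v w : List Basic) : Prop := v.length ≤ w.length ∧ mu v < mu w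

theorem Le.refl (w : List Basic) : Le w w := ⟨le_rfl, le_rfl⟩

theorem Le.trans {u v w : List Basic} (h : Le u v) (h' : Le v w) : Le u w :=
  ⟨h.1.trans h'.1, h.2.trans h'.2⟩

theorem Lt.le {v w : List Basic} (h : Lt v w) : Le v w := ⟨h.1, h.2.le⟩

theorem Lt.trans_le {u v w : List Basic} (h : Lt u v) (h' : Le v w) : Lt u w :=
  ⟨h.1.trans h'.1, h.2.trans_le h'.2⟩

theorem Le.congr {s w : List Basic} (u v : List Basic) (h : Le s w) :
    Le (u ++ s ++ v) (u ++ w ++ v) := by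
  simp only [Le, List.length_append, mu_append] at *
  omega

theorem Lt.congr {s w : List Basic} (u v : List Basic) (h : Lt s w) :
    Lt (u ++ s ++ v) (u ++ w ++ v) := by
  simp only [Lt, List.length_append, mu_append] at *
  omega

theorem Le.whisk {s w : List Basic} (A B : List ℤ) (h : Le s w) :
    Le (whisk A B s) (whisk A B w) := by
  have := Nat.mul_le_mul_left (2 * (A.length + B.length)) h.1
  simp only [Le, length_whisk, mu_whisk] at *
  omega

theorem Lt.whisk {s w : List Basic} (A B : List ℤ) (h : Lt s w) :
    Lt (whisk A B s) (whisk A B w) := by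
  have := Nat.mul_le_mul_left (2 * (A.length + B.length)) h.1
  simp only [Lt, length_whisk, mu_whisk] at *
  omega

theorem Le.mir {s w : List Basic} (h : Le s w) : Le (mir s) (mir w) := by
  simpa [Le] using h

theorem Lt.mir {s w : List Basic} (h : Lt s w) : Lt (mir s) (mir w) := by
  simpa [Lt] using h

/-- In all contexts, `w` is a combination of words in `S` which are at most as complex as `w`, and
of words less complex than `w`. -/
def Reduces (w : List Basic) (S : Set (List Basic)) : Prop :=
  Spn w {s | Lt s w ∨ (s ∈ S ∧ Le s w)}

namespace Reduces

variable {w w' : List Basic} {S S' : Set (List Basic)}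

theorem of_mem (h : w ∈ S) : Reduces w S := Spn.of_mem (.inr ⟨h, Le.refl w⟩)

theorem trans (h : Reduces w S) (h' : ∀ s ∈ S, Reduces s S') : Reduces w S' := by
  refine Spn.trans h ?_
  rintro s (hs | ⟨hs, hsw⟩)
  · exact Spn.of_mem (.inl hs)
  · refine (h' s hs).mono ?_
    rintro t (ht | ⟨ht, hts⟩)
    · exact .inl (ht.trans_le hsw)
    · exact .inr ⟨ht, hts.trans hsw⟩

theorem mono (h : Reduces w S) (hS : S ⊆ S') : Reduces w S' := h.trans fun _ hs => of_mem (hS hs)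

theorem of_empty (h : Reduces w ∅) : Reduces w S := h.mono (Set.empty_subset S)

theorem step (h : Reduces w {w'}) (h' : Reduces w' S) : Reduces w S :=
  h.trans fun _ hs => hs ▸ h'

theorem of_spn_empty (h : Spn w ∅) : Reduces w S := h.mono (Set.empty_subset _)

theorem congr (u v : List Basic) (h : Reduces w S) :
    Reduces (u ++ w ++ v) ((fun s => u ++ s ++ v) '' S) := by
  refine (Spn.congr u v h).mono ?_
  rintro _ ⟨s, hs | ⟨hs, hsw⟩, rfl⟩
  · exact .inl (hs.congr u v)
  · exact .inr ⟨⟨s, hs, rfl⟩, hsw.congr u v⟩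

theorem congr_single (u v : List Basic) (h : Reduces w {w'}) :
    Reduces (u ++ w ++ v) {u ++ w' ++ v} := by
  simpa using h.congr u v

theorem congr_empty (u v : List Basic) (h : Reduces w ∅) : Reduces (u ++ w ++ v) S := by
  simpa using (h.congr u v).mono (S' := S)

theorem whisk (A B : List ℤ) (h : Reduces w S) :
    Reduces (whisk A B w) (LegendrianTangle.whisk A B '' S) := by
  refine (Spn.whisk A B h).mono ?_
  rintro _ ⟨s, hs | ⟨hs, hsw⟩, rfl⟩
  · exact .inl (hs.whisk A B)
  · exact .inr ⟨⟨s, hs, rfl⟩, hsw.whisk A B⟩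

theorem mir (h : Reduces w S) : Reduces (mir w) (LegendrianTangle.mir '' S) := by
  refine (Spn.mir h).mono ?_
  rintro _ ⟨s, hs | ⟨hs, hsw⟩, rfl⟩
  · exact .inl hs.mir
  · exact .inr ⟨⟨s, hs, rfl⟩, hsw.mir⟩

theorem mir_empty (h : Reduces w ∅) : Reduces (LegendrianTangle.mir w) S := by
  simpa using h.mir.mono (S' := S)

theorem of_spn_le (h : Spn w {w'}) (hle : Le w' w) : Reduces w {w'} :=
  h.mono fun _ hs => .inr ⟨hs, hs ▸ hle⟩

theorem of_spn_lt (h : Spn w {w'}) (hlt : Lt w' w) : Reduces w S :=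
  h.mono fun _ hs => .inl (hs ▸ hlt)

end Reduces

/-! ### Interchange -/

theorem spn_single_trans {w w' w'' : List Basic} (h : Spn w {w'}) (h' : Spn w' {w''}) :
    Spn w {w''} := h.trans fun _ hs => hs ▸ h'

theorem spn_single_congr {w w' : List Basic} (u v : List Basic) (h : Spn w {w'}) :
    Spn (u ++ w ++ v) {u ++ w' ++ v} := by
  simpa using h.congr u v

section interchange

variable {X X' Y Y' : List ℤ} {u v : List Basic} (A M B : List ℤ)

/-- Two words at disjoint heights commute by repeated slides. Both directions are recorded because
`Spn` is not symmetric. -/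
theorem spn_interchange (hu : IsPath X u X') (hv : IsPath Y v Y') :
    Spn (whisk A (M ++ Y ++ B) u ++ whisk (A ++ X' ++ M) B v)
      {whisk (A ++ X ++ M) B v ++ whisk A (M ++ Y' ++ B) u} ∧
    Spn (whisk (A ++ X ++ M) B v ++ whisk A (M ++ Y' ++ B) u)
      {whisk A (M ++ Y ++ B) u ++ whisk (A ++ X' ++ M) B v} := by
  induction u generalizing X with
  | nil =>
    cases hu
    exact ⟨Spn.of_mem (by simp), Spn.of_mem (by simp)⟩
  | cons b u ih =>
    obtain ⟨rfl, hu⟩ := hu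
    -- One letter of the lower word is moved past the whole upper word, by an inner induction on the
    -- latter.
    have single : Spn (whisk A (M ++ Y ++ B) [b] ++ whisk (A ++ b.tgt ++ M) B v)
          {whisk (A ++ b.src ++ M) B v ++ whisk A (M ++ Y' ++ B) [b]} ∧
        Spn (whisk (A ++ b.src ++ M) B v ++ whisk A (M ++ Y' ++ B) [b])
          {whisk A (M ++ Y ++ B) [b] ++ whisk (A ++ b.tgt ++ M) B v} := by
      clear ih hu
      induction v generalizing Y with
      | nil =>
        cases hv
        exact ⟨Spn.of_mem (by simp), Spn.of_mem (by simp)⟩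
      | cons c v ih =>
        obtain ⟨rfl, hv⟩ := hv
        have slide := LocalMove.slide (A ++ b.lower) (b.upper ++ M ++ c.lower) (c.upper ++ B)
          b.elem c.elem
        have s₁ := slide.mv.spn
        have s₂ := (slide.mv_symm (by simp)).spn
        obtain ⟨i₁, i₂⟩ := ih hv
        constructor
        · refine spn_single_trans (w' := whisk (A ++ b.src ++ M) B [c] ++
            whisk A (M ++ c.tgt ++ B) [b] ++ whisk (A ++ b.tgt ++ M) B v) ?_ ?_
          · simpa [Basic.src, Basic.tgt] using
              spn_single_congr [] (whisk (A ++ b.tgt ++ M) B v) s₁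
          · simpa [Basic.src, Basic.tgt] using
              spn_single_congr (whisk (A ++ b.src ++ M) B [c]) [] i₁
        · refine spn_single_trans (w' := whisk (A ++ b.src ++ M) B [c] ++
            whisk A (M ++ c.tgt ++ B) [b] ++ whisk (A ++ b.tgt ++ M) B v) ?_ ?_
          · simpa [Basic.src, Basic.tgt] using
              spn_single_congr (whisk (A ++ b.src ++ M) B [c]) [] i₂
          · simpa [Basic.src, Basic.tgt] using
              spn_single_congr [] (whisk (A ++ b.tgt ++ M) B v) s₂
    obtain ⟨i₁, i₂⟩ := ih hu
    obtain ⟨s₁, s₂⟩ := single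
    constructor
    · refine spn_single_trans (w' := whisk A (M ++ Y ++ B) [b] ++
        whisk (A ++ b.tgt ++ M) B v ++ whisk A (M ++ Y' ++ B) u) ?_ ?_
      · simpa using spn_single_congr (whisk A (M ++ Y ++ B) [b]) [] i₁
      · simpa using spn_single_congr [] (whisk A (M ++ Y' ++ B) u) s₁
    · refine spn_single_trans (w' := whisk A (M ++ Y ++ B) [b] ++
        whisk (A ++ b.tgt ++ M) B v ++ whisk A (M ++ Y' ++ B) u) ?_ ?_
      · simpa using spn_single_congr [] (whisk A (M ++ Y' ++ B) u) s₂
      · simpa using spn_single_congr (whisk A (M ++ Y ++ B) [b]) [] i₂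

/-- Only the last summand depends on the order of the two words: each letter pays for the strands of
the other word beside it, counted at that word's near end. Comparing these summands decides in which
direction a slide lowers the complexity. -/
theorem mu_interchange :
    mu (whisk A (M ++ Y ++ B) u ++ whisk (A ++ X' ++ M) B v) =
      mu u + mu v + 2 * (A.length + M.length + B.length) * (u.length + v.length) +
        2 * (Y.length * u.length + X'.length * v.length) ∧
    mu (whisk (A ++ X ++ M) B v ++ whisk A (M ++ Y' ++ B) u) =
      mu u + mu v + 2 * (A.length + M.length + B.length) * (u.length + v.length) +
        2 * (Y'.length * u.length + X.length * v.length) := by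
  constructor <;>
  · simp only [mu_append, mu_whisk, List.length_append]
    ring

theorem reduces_interchange (hu : IsPath X u X') (hv : IsPath Y v Y')
    (h : Y'.length * u.length + X.length * v.length ≤ Y.length * u.length + X'.length * v.length) :
    Reduces (whisk A (M ++ Y ++ B) u ++ whisk (A ++ X' ++ M) B v)
      {whisk (A ++ X ++ M) B v ++ whisk A (M ++ Y' ++ B) u} := by
  refine Reduces.of_spn_le (spn_interchange A M B hu hv).1 ⟨by simp; omega, ?_⟩
  rw [(mu_interchange (X := X) (Y' := Y') A M B).1,
    (mu_interchange (X' := X') (Y := Y) A M B).2]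
  omega

theorem reduces_interchange_symm (hu : IsPath X u X') (hv : IsPath Y v Y')
    (h : Y.length * u.length + X'.length * v.length ≤ Y'.length * u.length + X.length * v.length) :
    Reduces (whisk (A ++ X ++ M) B v ++ whisk A (M ++ Y' ++ B) u)
      {whisk A (M ++ Y ++ B) u ++ whisk (A ++ X' ++ M) B v} := by
  refine Reduces.of_spn_le (spn_interchange A M B hu hv).2 ⟨by simp; omega, ?_⟩
  rw [(mu_interchange (X := X) (Y' := Y') A M B).1,
    (mu_interchange (X' := X') (Y := Y) A M B).2]
  omega

theorem reduces_interchange_empty (hu : IsPath X u X') (hv : IsPath Y v Y')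
    (h : Y'.length * u.length + X.length * v.length < Y.length * u.length + X'.length * v.length) :
    Reduces (whisk A (M ++ Y ++ B) u ++ whisk (A ++ X' ++ M) B v) ∅ := by
  refine Reduces.of_spn_lt (spn_interchange A M B hu hv).1 ⟨by simp; omega, ?_⟩
  rw [(mu_interchange (X := X) (Y' := Y') A M B).1,
    (mu_interchange (X' := X') (Y := Y) A M B).2]
  omega

theorem reduces_interchange_symm_empty (hu : IsPath X u X') (hv : IsPath Y v Y')
    (h : Y.length * u.length + X'.length * v.length < Y'.length * u.length + X.length * v.length) :
    Reduces (whisk (A ++ X ++ M) B v ++ whisk A (M ++ Y' ++ B) u) ∅ := by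
  refine Reduces.of_spn_lt (spn_interchange A M B hu hv).2 ⟨by simp; omega, ?_⟩
  rw [(mu_interchange (X := X) (Y' := Y') A M B).1,
    (mu_interchange (X' := X') (Y := Y) A M B).2]
  omega

end interchange

/-! ### Words of crossings -/

/-- All letters are crossings. -/
def IsBraid (w : List Basic) : Prop := ∀ b ∈ w, b.elem.IsCrossing

theorem IsBraid.length_eq {X Y : List ℤ} {w : List Basic} (hw : IsBraid w) (h : IsPath X w Y) :
    X.length = Y.length := by
  induction w generalizing X with
  | nil => rw [show X = Y from h]
  | cons b w ih =>
    have := ih (fun c hc => hw c (List.mem_cons_of_mem _ hc)) h.2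
    have hb := hw b List.mem_cons_self
    rw [← this, h.1]
    rcases b with ⟨A, _ | _ | _, B⟩
    · simp [Basic.src, Basic.tgt, Elem.src, Elem.tgt]
    · exact hb.elim
    · exact hb.elim

/-- The strand `x` above the strands `A` passes all of the strands `M` above it. -/
def up : List ℤ → ℤ → List ℤ → List ℤ → List Basic
  | _, _, [], _ => []
  | A, x, m :: M, B => ⟨A, .crossing x m, M ++ B⟩ :: up (A ++ [m]) x M B

@[simp] theorem up_nil (A : List ℤ) (x : ℤ) (B : List ℤ) : up A x [] B = [] := rfl

@[simp] theorem whisk_up (C D A : List ℤ) (x : ℤ) (M B : List ℤ) :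
    whisk C D (up A x M B) = up (C ++ A) x M (B ++ D) := by
  induction M generalizing A with
  | nil => rfl
  | cons m M ih => simp [up, ih]

theorem up_append (A : List ℤ) (x : ℤ) (M N B : List ℤ) :
    up A x (M ++ N) B = up A x M (N ++ B) ++ up (A ++ M) x N B := by
  induction M generalizing A with
  | nil => simp
  | cons m M ih => simp [up, ih]

theorem isPath_up (A : List ℤ) (x : ℤ) (M B : List ℤ) :
    IsPath (A ++ x :: (M ++ B)) (up A x M B) (A ++ M ++ x :: B) := by
  induction M generalizing A with
  | nil => simp [IsPath]
  | cons m M ih =>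
    refine ⟨by simp [Basic.src, Elem.src], ?_⟩
    simpa [Basic.tgt, Elem.tgt] using ih (A ++ [m])

theorem isBraid_up (A : List ℤ) (x : ℤ) (M B : List ℤ) : IsBraid (up A x M B) := by
  induction M generalizing A with
  | nil => simp [IsBraid]
  | cons m M ih =>
    intro b hb
    rcases List.mem_cons.1 hb with rfl | hb
    · trivial
    · exact ih _ b hb

/-- Three strands, one of them passing the others and a bunch `M` of further strands. -/
theorem reduces_pass (a b : ℤ) (M B : List ℤ) :
    Reduces (⟨[], .crossing a b, M ++ B⟩ :: (up [b] a M B ++ up [] b M (a :: B)))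
      {up [a] b M B ++ up [] a M (b :: B) ++ [⟨M, .crossing a b, B⟩]} := by
  induction M with
  | nil => exact Reduces.of_mem (by simp)
  | cons m M ih =>
    -- After `i₁` the three crossings among `a`, `b` and the lowest strand `m` of the bunch are
    -- adjacent, so a third Reidemeister move applies. The induction hypothesis then carries the
    -- crossing of `a` and `b` past `M`, and `i₂` restores the order of the remaining crossings.
    have i₁ := reduces_interchange_symm [] [] [] (u := [⟨[], .crossing b m, []⟩]) (X := [b, m])
      (X' := [m, b]) (v := up [] a M B) (Y := a :: (M ++ B)) (Y' := M ++ a :: B)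
      ⟨rfl, rfl⟩ (by simpa using isPath_up [] a M B) (by simp)
    have i₂ := reduces_interchange [] [] [] (u := [⟨[], .crossing a m, []⟩]) (X := [a, m])
      (X' := [m, a]) (v := up [] b M B) (Y := b :: (M ++ B)) (Y' := M ++ b :: B)
      ⟨rfl, rfl⟩ (by simpa using isPath_up [] b M B) (by simp; omega)
    have r₃ : Reduces _ _ := Reduces.of_spn_le (LocalMove.reidemeister3 [] (M ++ B) a b m).mv.spn
      (by simp [Le, Basic.weight, Basic.src, Basic.tgt, Elem.src, Elem.tgt])
    have ih' := ih.whisk [m] []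
    rw [Set.image_singleton] at ih'
    have j₁ := i₁.congr_single [⟨[], .crossing a b, m :: (M ++ B)⟩, ⟨[b], .crossing a m, M ++ B⟩]
      (up [m] b M (a :: B))
    have j₂ := r₃.congr_single [] (up [m, b] a M B ++ up [m] b M (a :: B))
    have j₃ := ih'.congr_single [⟨[a], .crossing b m, M ++ B⟩, ⟨[], .crossing a m, b :: (M ++ B)⟩] []
    have j₄ := i₂.congr_single [⟨[a], .crossing b m, M ++ B⟩]
      (up [m] a M (b :: B) ++ [⟨m :: M, .crossing a b, B⟩])
    simp only [up, whisk_cons, whisk_nil, whisk_append, whisk_up, List.append_nil, List.nil_append,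
      List.cons_append, List.append_assoc] at j₁ j₂ j₃ j₄ ⊢
    exact j₁.step (j₂.step (j₃.step j₄))

/-- Standard words for permutation braids. -/
inductive PermWord : List ℤ → List Basic → List ℤ → Prop
  | nil : PermWord [] [] []
  | cons {X : List ℤ} {w : List Basic} (x : ℤ) (M B : List ℤ) : PermWord X w (M ++ B) →
      PermWord (x :: X) (whisk [x] [] w ++ up [] x M B) (M ++ x :: B)

namespace PermWord

theorem isPath {X Y : List ℤ} {w : List Basic} (h : PermWord X w Y) : IsPath X w Y := by
  induction h with
  | nil => rfl
  | @cons X w x M B _ ih =>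
    refine isPath_append (Y := x :: (M ++ B)) ?_ (by simpa using isPath_up [] x M B)
    simpa using (isPath_whisk_iff [x] [] X (M ++ B) w).2 ih

theorem isBraid {X Y : List ℤ} {w : List Basic} (h : PermWord X w Y) : IsBraid w := by
  induction h with
  | nil => simp [IsBraid]
  | @cons X w x M B _ ih =>
    intro b hb
    rcases List.mem_append.1 hb with hb | hb
    · obtain ⟨c, hc, rfl⟩ := List.mem_map.1 hb
      exact ih c hc
    · exact isBraid_up _ _ _ _ b hb

theorem id (X : List ℤ) : PermWord X [] X := by
  induction X with
  | nil => exact .nil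
  | cons x X ih => exact .cons x [] X ih

end PermWord

/-- Every term resolving a double crossing has smaller complexity: the empty word, a single
crossing, and a pair of cusps, whose letters have fewer ends than crossings. The target set is
therefore arbitrary. -/
theorem reduces_double_crossing (A B : List ℤ) (a b : ℤ) (S : Set (List Basic)) :
    Reduces [⟨A, .crossing a b, B⟩, ⟨A, .crossing b a, B⟩] S := by
  refine (spn_double_crossing A B a b).mono ?_
  rintro s (rfl | rfl | rfl) <;> left <;>
    (simp [Lt, Basic.weight, Basic.src, Basic.tgt, Elem.src, Elem.tgt]; try omega)

/-- A crossing composed with a standard permutation braid. -/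
theorem PermWord.reduces_crossing {A C : List ℤ} {a b : ℤ} {Y : List ℤ} {p : List Basic}
    (h : PermWord (A ++ b :: a :: C) p Y) :
    Reduces (⟨A, .crossing a b, C⟩ :: p) {w | PermWord (A ++ a :: b :: C) w Y} := by
  induction A generalizing p Y with
  | cons x A ih =>
    cases h with
    | @cons _ w _ M B h =>
      have := (ih h).whisk [x] []
      have := this.congr [] (up [] x M B)
      simp only [whisk_cons, List.append_nil, List.nil_append, List.cons_append] at this
      refine this.mono ?_
      rintro _ ⟨_, ⟨s, hs, rfl⟩, rfl⟩
      exact .cons x M B hs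
  | nil =>
    obtain ⟨M, B, w₁, hM, rfl, rfl⟩ : ∃ M B w, PermWord (a :: C) w (M ++ B) ∧
        p = whisk [b] [] w ++ up [] b M B ∧ Y = M ++ b :: B := by
      cases h with
      | @cons _ w _ M B h => exact ⟨M, B, w, h, rfl, rfl⟩
    obtain ⟨M₁, B₁, w, hw, rfl, e⟩ : ∃ M₁ B₁ w, PermWord C w (M₁ ++ B₁) ∧
        w₁ = whisk [a] [] w ++ up [] a M₁ B₁ ∧ M ++ B = M₁ ++ a :: B₁ := by
      generalize hN : M ++ B = N at hM
      cases hM with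
      | @cons _ w _ M B h' => exact ⟨M, B, w, h', rfl, rfl⟩
    have hlen := hw.isBraid.length_eq hw.isPath
    -- The new crossing is slid to the right past the braid `w` of the other strands, up to where
    -- `a` and then `b` travel upwards.
    have i₁ := (reduces_interchange [] [] [] (u := [⟨[], .crossing a b, []⟩]) (X := [a, b])
      (X' := [b, a]) ⟨rfl, rfl⟩ hw.isPath (by simp; simp at hlen; omega)).congr_single []
      (up [b] a M₁ B₁ ++ up [] b M B)
    simp only [whisk_cons, whisk_nil, whisk_append, whisk_up, whisk_whisk, List.append_nil,
      List.nil_append, List.cons_append, List.append_assoc] at i₁ ⊢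
    refine i₁.step ?_
    clear i₁
    -- The lengths of `M` and `M₁` decide whether `b` goes past `a` in the given braid. If it does,
    -- the new crossing creates a double crossing.
    rcases List.append_eq_append_iff.1 e with ⟨M₂, rfl, rfl⟩ | ⟨M₂, rfl, hB⟩
    · -- the two strands cross once
      have j₁ := reduces_interchange_symm [] [] B₁ (u := up [] b M []) (v := up [] a M₂ [])
        (X := b :: M) (X' := M ++ [b]) (Y := a :: M₂) (Y' := M₂ ++ [a])
        (by simpa using isPath_up [] b M []) (by simpa using isPath_up [] a M₂ []) (by simp)
      have j₁' := j₁.congr_single (whisk [a, b] [] w ++ [⟨[], .crossing a b, M ++ M₂ ++ B₁⟩] ++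
        up [b] a M (M₂ ++ B₁)) []
      have j₂ := (reduces_pass a b M (M₂ ++ B₁)).congr_single (whisk [a, b] [] w)
        (up (M ++ [b]) a M₂ B₁)
      simp only [up_append, whisk_up, List.append_nil, List.nil_append, List.cons_append,
        List.append_assoc] at j₁' j₂ ⊢
      refine j₁'.step (j₂.step (Reduces.of_mem ?_))
      have k₁ : PermWord (b :: C) (whisk [b] [] w ++ up [] b M (M₂ ++ B₁))
        (M ++ b :: (M₂ ++ B₁)) := .cons b M (M₂ ++ B₁) (by simpa using hw)
      have k₂ := PermWord.cons (w := whisk [b] [] w ++ up [] b M (M₂ ++ B₁)) a (M ++ b :: M₂) B₁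
        (by simpa using k₁)
      simpa [up_append, up] using k₂
    · rcases List.cons_eq_append_iff.1 hB with ⟨rfl, rfl⟩ | ⟨M₃, rfl, rfl⟩
      · -- the case `M = M₁`
        have j₂ := (reduces_pass a b M₁ B₁).congr_single (whisk [a, b] [] w) []
        simp only [List.append_nil, List.append_assoc] at j₂ ⊢
        refine j₂.step (Reduces.of_mem ?_)
        have k₁ : PermWord (b :: C) (whisk [b] [] w ++ up [] b M₁ B₁) (M₁ ++ b :: B₁) :=
          .cons b M₁ B₁ hw
        have k₂ := PermWord.cons (w := whisk [b] [] w ++ up [] b M₁ B₁) a (M₁ ++ [b]) B₁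
          (by simpa using k₁)
        simpa [up_append, up] using k₂
      · -- the two strands cross twice
        have j₂ := (reduces_pass a b M₁ (M₃ ++ B)).congr_single (whisk [a, b] [] w)
          (up M₁ b (a :: M₃) B)
        have j₃ := (reduces_double_crossing M₁ (M₃ ++ B) a b ∅).congr_empty
          (S := {w | PermWord ([] ++ a :: b :: C) w (M₁ ++ a :: M₃ ++ b :: B)})
          (whisk [a, b] [] w ++ up [a] b M₁ (M₃ ++ B) ++ up [] a M₁ (b :: (M₃ ++ B)))
          (up (M₁ ++ [a]) b M₃ B)
        simp only [up, up_append, List.nil_append, List.cons_append, List.append_assoc] at j₂ j₃ ⊢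
        exact j₂.step j₃

/-- Words of crossings are combinations of standard permutation braids. -/
theorem IsBraid.reduces {X Y : List ℤ} {w : List Basic} (hw : IsBraid w) (h : IsPath X w Y) :
    Reduces w {p | PermWord X p Y} := by
  induction w generalizing X with
  | nil =>
    cases h
    exact Reduces.of_mem (PermWord.id _)
  | cons b w ih =>
    obtain ⟨rfl, h⟩ := h
    have hb := hw b List.mem_cons_self
    rcases b with ⟨A, ⟨m, n⟩ | _ | _, B⟩
    · have := (ih (fun c hc => hw c (List.mem_cons_of_mem _ hc)) h).congr
        [⟨A, .crossing m n, B⟩] []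
      simp only [List.append_nil, List.cons_append, List.nil_append] at this
      refine this.trans ?_
      rintro _ ⟨p, hp, rfl⟩
      have hp' : PermWord (A ++ n :: m :: B) p Y := by
        simpa [Basic.tgt, Elem.tgt] using hp
      simpa [Basic.src, Elem.src] using hp'.reduces_crossing
    · exact hb.elim
    · exact hb.elim

/-! ### Cusps against strands and braids -/

/-- A strand crossing the lower branch of a left cusp from below can be replaced by one crossing the
upper branch from above. -/
theorem reduces_push_leftCusp (A B : List ℤ) (k n : ℤ) :
    Reduces [⟨A ++ [n], .leftCusp k, B⟩, ⟨A, .crossing n (k + 1), k :: B⟩]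
      {[⟨A, .leftCusp k, n :: B⟩, ⟨A ++ [k + 1], .crossing k n, B⟩]} := by
  -- The double crossing is inserted between the strand `n` and the upper branch `k`. Its first
  -- crossing completes a second Reidemeister move that takes the strand off the cusp, and its
  -- second crossing remains.
  have h := spn_create_crossings (A := A ++ [k + 1]) (B := B) (a := n) (b := k)
    (u := [⟨A ++ [n], .leftCusp k, B⟩, ⟨A, .crossing n (k + 1), k :: B⟩])
    (v := []) (X := A ++ [n] ++ B) (Y := A ++ [k + 1] ++ [n, k] ++ B)
    (by simp [IsPath, Basic.src, Basic.tgt, Elem.src, Elem.tgt]) rfl (by simp)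
  have r := (LocalMove.reidemeister2_left_above A B k n).mv.spn
  refine h.trans ?_
  -- The correction terms are lower: for `n = k` the second Reidemeister move removes both
  -- crossings, and for `n = k + 1` the inserted right cusp completes a first Reidemeister move.
  rintro s (rfl | ⟨rfl, rfl⟩ | ⟨rfl, rfl⟩)
  · have := spn_single_congr [] [⟨A ++ [k + 1], .crossing k n, B⟩] r
    refine (Spn.mono (S := {_}) this ?_)
    rintro _ rfl
    exact .inr ⟨rfl, by simp [Le, Basic.weight, Basic.src, Basic.tgt, Elem.src, Elem.tgt]⟩
  · refine r.mono ?_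
    rintro _ rfl
    left
    simp [Lt, Basic.weight, Basic.src, Basic.tgt, Elem.src, Elem.tgt]
  · have r' := (LocalMove.reidemeister1_above A B k).mv.spn
    have := spn_single_congr [] [⟨A ++ [k + 1], .leftCusp k, B⟩] r'
    refine (Spn.mono (S := {_}) this ?_)
    rintro _ rfl
    left
    simp [Lt, Basic.weight, Basic.src, Basic.tgt, Elem.src, Elem.tgt]

theorem reduces_push_rightCusp (A B : List ℤ) (k n : ℤ) :
    Reduces [⟨A, .crossing (k + 1) n, k :: B⟩, ⟨A ++ [n], .rightCusp k, B⟩]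
      {[⟨A ++ [k + 1], .crossing n k, B⟩, ⟨A, .rightCusp k, n :: B⟩]} := by
  simpa [Basic.mirror, Elem.mirror] using (reduces_push_leftCusp A B k n).mir

/-- Standard words for left cusp tangles. -/
def leftCuspWord (A : List ℤ) (k : ℤ) (M B : List ℤ) : List Basic :=
  ⟨A, .leftCusp k, M ++ B⟩ :: up (A ++ [k + 1]) k M B

theorem isPath_leftCuspWord (A : List ℤ) (k : ℤ) (M B : List ℤ) :
    IsPath (A ++ (M ++ B)) (leftCuspWord A k M B) (A ++ (k + 1) :: (M ++ k :: B)) := by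
  refine ⟨by simp [Basic.src, Elem.src], ?_⟩
  simpa [Basic.tgt, Elem.tgt] using isPath_up (A ++ [k + 1]) k M B

/-- A left cusp composed with a standard permutation braid. -/
theorem PermWord.reduces_leftCusp {A B : List ℤ} {k : ℤ} {Y : List ℤ} {p : List Basic}
    (h : PermWord (A ++ (k + 1) :: k :: B) p Y) :
    Reduces (⟨A, .leftCusp k, B⟩ :: p)
      {w | ∃ A' M B', w = leftCuspWord A' k M B' ∧ Y = A' ++ (k + 1) :: (M ++ k :: B')} := by
  induction A generalizing p Y with
  | nil =>
    obtain ⟨M, C, w₁, hM, rfl, rfl⟩ : ∃ M C w, PermWord (k :: B) w (M ++ C) ∧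
        p = whisk [k + 1] [] w ++ up [] (k + 1) M C ∧ Y = M ++ (k + 1) :: C := by
      cases h with
      | @cons _ w _ M B h => exact ⟨M, B, w, h, rfl, rfl⟩
    obtain ⟨M₁, B₁, w, hw, rfl, e⟩ : ∃ M₁ B₁ w, PermWord B w (M₁ ++ B₁) ∧
        w₁ = whisk [k] [] w ++ up [] k M₁ B₁ ∧ M ++ C = M₁ ++ k :: B₁ := by
      generalize hN : M ++ C = N at hM
      cases hM with
      | @cons _ w _ M B h' => exact ⟨M, B, w, h', rfl, rfl⟩
    have hlen := hw.isBraid.length_eq hw.isPath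
    -- A nonempty braid `w` of the other strands can be moved to the left of the cusp, where its
    -- crossings have two strands fewer beside them.
    rcases eq_or_ne w [] with rfl | hne
    · cases (show B = M₁ ++ B₁ from hw.isPath)
      -- If the lower branch crosses nothing, the word is already standard. Otherwise its first
      -- crossing is either with the upper branch, giving a crossed cusp, or with a strand that the
      -- upper branch has also crossed, giving a second Reidemeister move.
      rcases M with _ | ⟨m, M⟩
      · exact Reduces.of_mem ⟨[], M₁, B₁, by simp [leftCuspWord], by simpa using e⟩
      rcases M₁ with _ | ⟨m₁, M₁⟩
      · obtain ⟨rfl, rfl⟩ : m = k ∧ M ++ C = B₁ := by simpa using e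
        have := (Reduces.of_spn_empty (S := ∅) (spn_crossed_leftCusp [] (M ++ C) m)).congr_empty
          (S := {w | ∃ A' M' B', w = leftCuspWord A' m M' B' ∧
            m :: M ++ (m + 1) :: C = A' ++ (m + 1) :: (M' ++ m :: B')}) []
          (up [m] (m + 1) M C)
        simpa [up] using this
      · obtain ⟨rfl, e₁⟩ : m = m₁ ∧ M ++ C = M₁ ++ k :: B₁ := by simpa using e
        have j₁ := (reduces_interchange_symm [] [] [] (u := [⟨[], .crossing (k + 1) m, []⟩])
          (X := [k + 1, m]) (X' := [m, k + 1]) (v := up [] k M₁ B₁) (Y := k :: (M₁ ++ B₁))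
          (Y' := M₁ ++ k :: B₁) ⟨rfl, rfl⟩ (by simpa using isPath_up [] k M₁ B₁)
          (by simp)).congr_single
          [⟨[], .leftCusp k, m :: (M₁ ++ B₁)⟩, ⟨[k + 1], .crossing k m, M₁ ++ B₁⟩]
          (up [m] (k + 1) M C)
        have j₂ := (Reduces.of_spn_lt (S := ∅)
          (LocalMove.reidemeister2_left_below [] (M₁ ++ B₁) k m).mv.spn
          (by simp [Lt, Basic.weight, Basic.src, Basic.tgt, Elem.src, Elem.tgt])).congr_empty
          (S := {w | ∃ A' M' B', w = leftCuspWord A' k M' B' ∧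
            m :: M ++ (k + 1) :: C = A' ++ (k + 1) :: (M' ++ k :: B')}) []
          (up [m, k + 1] k M₁ B₁ ++ up [m] (k + 1) M C)
        simp only [up, e₁, whisk_cons, whisk_nil, whisk_up, List.append_nil, List.append_assoc,
          List.nil_append, List.cons_append] at j₁ j₂ ⊢
        exact j₁.step j₂
    · have := (reduces_interchange_empty [] [] [] (u := [⟨[], .leftCusp k, []⟩]) (X := [])
        (X' := [k + 1, k]) ⟨rfl, rfl⟩ hw.isPath (by
          have := List.length_pos_iff.2 hne
          simp at hlen ⊢; rw [hlen]; omega)).congr_empty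
        (S := {w | ∃ A' M' B', w = leftCuspWord A' k M' B' ∧
          M ++ (k + 1) :: C = A' ++ (k + 1) :: (M' ++ k :: B')}) []
        (up [k + 1] k M₁ B₁ ++ up [] (k + 1) M C)
      simpa using this
  | cons x A ih =>
    obtain ⟨M, C, w, hM, rfl, rfl⟩ : ∃ M C w, PermWord (A ++ (k + 1) :: k :: B) w (M ++ C) ∧
        p = whisk [x] [] w ++ up [] x M C ∧ Y = M ++ x :: C := by
      cases h with
      | @cons _ w _ M B h => exact ⟨M, B, w, h, rfl, rfl⟩
    have := ((ih hM).whisk [x] []).congr [] (up [] x M C)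
    simp only [whisk_cons, List.append_nil, List.nil_append, List.cons_append] at this
    refine this.trans ?_
    rintro _ ⟨_, ⟨_, ⟨A, N, B, rfl, e⟩, rfl⟩, rfl⟩
    rcases M with _ | ⟨m, M⟩
    · refine Reduces.of_mem ⟨x :: A, N, B, ?_, ?_⟩
      · simp [leftCuspWord]
      · simp only [List.nil_append] at e
        simp [e]
    rcases A with _ | ⟨a, A⟩
    · -- the strand `x` meets the lower branch of the cusp
      obtain ⟨rfl, e₁⟩ : m = k + 1 ∧ M ++ C = N ++ k :: B := by simpa using e
      have j₁ := (reduces_interchange_symm [] [] [] (u := [⟨[], .crossing x (k + 1), []⟩])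
        (X := [x, k + 1]) (X' := [k + 1, x]) (v := up [] k N B) (Y := k :: (N ++ B))
        (Y' := N ++ k :: B) ⟨rfl, rfl⟩ (by simpa using isPath_up [] k N B)
        (by simp)).congr_single [⟨[x], .leftCusp k, N ++ B⟩] (up [k + 1] x M C)
      have j₂ := (reduces_push_leftCusp [] (N ++ B) k x).congr_single []
        (up [k + 1, x] k N B ++ up [k + 1] x M C)
      simp only [leftCuspWord, up, e₁, whisk_cons, whisk_nil, whisk_up, List.append_nil,
        List.append_assoc, List.nil_append, List.cons_append] at j₁ j₂ ⊢
      refine j₁.step (j₂.step ?_)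
      clear j₁ j₂
      -- The cusp now starts below `x`, and its upper branch crosses `x` first. If `x` then stops,
      -- the word is standard with `x` added to the strands crossed. If it goes on, it meets either
      -- the upper branch again or another strand crossed by that branch.
      rcases M with _ | ⟨m, M⟩
      · refine Reduces.of_mem ⟨[], x :: N, B, by simp [up], ?_⟩
        simp only [List.nil_append] at e₁
        simp [e₁]
      rcases N with _ | ⟨n, N⟩
      · obtain ⟨rfl, rfl⟩ : m = k ∧ M ++ C = B := by simpa using e₁
        exact (reduces_double_crossing [m + 1] (M ++ C) m x ∅).congr_empty
          [⟨[], .leftCusp m, x :: (M ++ C)⟩] (up [m + 1, m] x M C)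
      · obtain ⟨rfl, e₂⟩ : m = n ∧ M ++ C = N ++ k :: B := by simpa using e₁
        have j₁ := (reduces_interchange_symm [k + 1] [] [] (u := [⟨[], .crossing x m, []⟩])
          (X := [x, m]) (X' := [m, x]) (v := up [] k N B) (Y := k :: (N ++ B))
          (Y' := N ++ k :: B) ⟨rfl, rfl⟩ (by simpa using isPath_up [] k N B)
          (by simp)).congr_single [⟨[], .leftCusp k, x :: m :: (N ++ B)⟩,
            ⟨[k + 1], .crossing k x, m :: (N ++ B)⟩, ⟨[k + 1, x], .crossing k m, N ++ B⟩]
          (up [k + 1, m] x M C)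
        -- A third Reidemeister move takes the crossing of `x` and `m` to the other side of the
        -- upper branch. It is then next to the cusp and disjoint from it, and sliding it to the
        -- left lowers the complexity.
        have j₂ := (Reduces.of_spn_le
          (LocalMove.reidemeister3 [k + 1] (N ++ B) k x m).mv.spn
          (by simp [Le, Basic.weight, Basic.src, Basic.tgt, Elem.src, Elem.tgt])).congr_single
          [⟨[], .leftCusp k, x :: m :: (N ++ B)⟩]
          (up [k + 1, m, x] k N B ++ up [k + 1, m] x M C)
        have j₃ := (reduces_interchange_empty [] [] (N ++ B) (u := [⟨[], .leftCusp k, []⟩])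
          (v := [⟨[], .crossing x m, []⟩]) (X := []) (X' := [k + 1, k]) (Y := [x, m])
          (Y' := [m, x]) ⟨rfl, rfl⟩ ⟨rfl, rfl⟩ (by simp)).congr_empty
          (S := {w | ∃ A' M' B', w = leftCuspWord A' k M' B' ∧
            (k + 1) :: m :: (M ++ x :: C) = A' ++ (k + 1) :: (M' ++ k :: B')}) []
          (⟨[k + 1], .crossing k m, x :: (N ++ B)⟩ :: ⟨[k + 1, m], .crossing k x, N ++ B⟩ ::
            (up [k + 1, m, x] k N B ++ up [k + 1, m] x M C))
        simp only [up, e₂, whisk_cons, whisk_nil, whisk_up, List.append_nil, List.append_assoc,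
          List.nil_append, List.cons_append] at j₁ j₂ j₃ ⊢
        exact j₁.step (j₂.step j₃)
    · -- the strand `x` first meets a strand below the cusp
      obtain ⟨rfl, e₁⟩ : m = a ∧ M ++ C = A ++ (k + 1) :: (N ++ k :: B) := by simpa using e
      have := (reduces_interchange_symm_empty [] [] [] (u := [⟨[], .crossing x m, []⟩])
        (v := leftCuspWord A k N B) (X := [x, m]) (X' := [m, x]) ⟨rfl, rfl⟩
        (isPath_leftCuspWord A k N B) (by simp)).congr_empty
        (S := {w | ∃ A' M' B', w = leftCuspWord A' k M' B' ∧
            m :: (M ++ x :: C) = A' ++ (k + 1) :: (M' ++ k :: B')}) [] (up [m] x M C)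
      simpa [up, e₁, leftCuspWord] using this

/-! ### Standard cusp tangles against cusps and crossings -/

theorem IsPath.src_unique {X X' Y : List ℤ} {w : List Basic} (h : IsPath X w Y)
    (h' : IsPath X' w Y) : X = X' :=
  (isPath_mir_iff.2 h).tgt_unique (isPath_mir_iff.2 h')

theorem IsPath.leftCuspWord_ends {X Y A M B : List ℤ} {k : ℤ}
    (h : IsPath X (leftCuspWord A k M B) Y) :
    X = A ++ (M ++ B) ∧ Y = A ++ (k + 1) :: (M ++ k :: B) := by
  have e : X = A ++ (M ++ B) := by simpa [Basic.src, Elem.src] using h.1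
  subst e
  exact ⟨rfl, h.tgt_unique (isPath_leftCuspWord A k M B)⟩

/-- A left cusp followed by a right cusp. -/
theorem reduces_leftCusp_rightCusp {A B C D : List ℤ} {n k : ℤ}
    (h : A ++ (n + 1) :: n :: B = C ++ (k + 1) :: k :: D) (S : Set (List Basic)) :
    Reduces [⟨A, .leftCusp n, B⟩, ⟨C, .rightCusp k, D⟩] S := by
  -- The two cusps share two strands (an unknot), one strand (a zigzag of one of the two kinds), or
  -- none (a slide separates them at lower cost).
  rcases List.append_eq_append_iff.1 h with ⟨E, rfl, hE⟩ | ⟨E, rfl, hE⟩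
  · rcases E with _ | ⟨e, _ | ⟨f, E⟩⟩
    · obtain ⟨rfl, rfl⟩ : n = k ∧ B = D := by simpa using hE
      simpa using Reduces.of_spn_lt (spn_unknot A B n)
        (by simp [Lt, Basic.weight, Basic.src, Basic.tgt, Elem.src, Elem.tgt])
    · obtain ⟨rfl, rfl, rfl⟩ : n + 1 = e ∧ n = k + 1 ∧ B = k :: D := by simpa using hE
      exact Reduces.of_spn_empty (spn_zigzag A D k)
    · obtain ⟨rfl, rfl, rfl⟩ : n + 1 = e ∧ n = f ∧ B = E ++ (k + 1) :: k :: D := by simpa using hE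
      have := (reduces_interchange_empty A E D (u := [⟨[], .leftCusp n, []⟩])
        (v := [⟨[], .rightCusp k, []⟩]) (X := []) (X' := [n + 1, n]) (Y := [k + 1, k])
        (Y' := []) ⟨rfl, rfl⟩ ⟨rfl, rfl⟩ (by simp)).of_empty (S := S)
      simpa using this
  · rcases E with _ | ⟨e, _ | ⟨f, E⟩⟩
    · obtain ⟨rfl, rfl⟩ : k = n ∧ D = B := by simpa using hE
      simpa using Reduces.of_spn_lt (spn_unknot C D k)
        (by simp [Lt, Basic.weight, Basic.src, Basic.tgt, Elem.src, Elem.tgt])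
    · obtain ⟨rfl, rfl, rfl⟩ : k + 1 = e ∧ k = n + 1 ∧ D = n :: B := by simpa using hE
      exact Reduces.of_spn_empty (spn_zigzag' C B n)
    · obtain ⟨rfl, rfl, rfl⟩ : k + 1 = e ∧ k = f ∧ D = E ++ (n + 1) :: n :: B := by simpa using hE
      have := (reduces_interchange_symm_empty C E B (u := [⟨[], .rightCusp k, []⟩])
        (v := [⟨[], .leftCusp n, []⟩]) (X := [k + 1, k]) (X' := []) (Y := [])
        (Y' := [n + 1, n]) ⟨rfl, rfl⟩ ⟨rfl, rfl⟩ (by simp)).of_empty (S := S)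
      simpa using this

/-- A standard left cusp tangle followed by a right cusp. -/
theorem reduces_leftCuspWord_rightCusp {A M B C D : List ℤ} {n k : ℤ}
    (h : A ++ (n + 1) :: (M ++ n :: B) = C ++ (k + 1) :: k :: D) (S : Set (List Basic)) :
    Reduces (leftCuspWord A n M B ++ [⟨C, .rightCusp k, D⟩]) S := by
  rcases List.eq_nil_or_concat' M with rfl | ⟨M, m, rfl⟩
  · simpa [leftCuspWord] using reduces_leftCusp_rightCusp (by simpa using h) S
  have hw : leftCuspWord A n (M ++ [m]) B ++ [⟨C, .rightCusp k, D⟩] = leftCuspWord A n M (m :: B) ++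
      [⟨A ++ (n + 1) :: M, .crossing n m, B⟩, ⟨C, .rightCusp k, D⟩] := by
    simp [leftCuspWord, up_append, up]
  rw [hw]
  clear hw
  have h' : (A ++ (n + 1) :: M) ++ m :: n :: B = C ++ (k + 1) :: k :: D := by simpa using h
  -- The last crossing of the cusp tangle, between `m` and the upper branch `n`, is compared with
  -- the position of the right cusp.
  rcases List.append_eq_append_iff.1 h' with ⟨E, rfl, hE⟩ | ⟨E, hC, hE⟩
  · rcases E with _ | ⟨e, _ | ⟨f, E⟩⟩
    · obtain ⟨rfl, rfl, rfl⟩ : m = k + 1 ∧ n = k ∧ B = D := by simpa using hE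
      have := (Reduces.of_spn_empty (S := ∅)
        (spn_crossed_rightCusp (A ++ (n + 1) :: M) B n)).congr_empty (S := S)
        (leftCuspWord A n M ((n + 1) :: B)) []
      simpa using this
    · obtain ⟨rfl, rfl, rfl⟩ : m = e ∧ n = k + 1 ∧ B = k :: D := by simpa using hE
      -- The right cusp contains the branch `n` but not `m`. Pushing `m` to the other branch of the
      -- right cusp turns its crossing into one with `k`, disjoint from the rest of the left cusp
      -- tangle and cheaper on its left.
      have j₁ := (reduces_push_rightCusp (A ++ (k + 1 + 1) :: M) D k m).congr_single
        (leftCuspWord A (k + 1) M (m :: k :: D)) []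
      have j₂ := (reduces_interchange_empty [] [] D (u := leftCuspWord A (k + 1) M [])
        (v := [⟨[], .crossing m k, []⟩]) (Y := [m, k]) (Y' := [k, m])
        (isPath_leftCuspWord A (k + 1) M []) ⟨rfl, rfl⟩ (by simp)).congr_empty (S := S) []
        [⟨A ++ (k + 1 + 1) :: M, .rightCusp k, m :: D⟩]
      simp only [leftCuspWord, whisk_cons, whisk_nil, whisk_up, List.append_nil, List.append_assoc,
        List.nil_append, List.cons_append] at j₁ j₂ ⊢
      exact j₁.step j₂
    · obtain ⟨rfl, rfl, rfl⟩ : m = e ∧ n = f ∧ B = E ++ (k + 1) :: k :: D := by simpa using hE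
      have := (reduces_interchange_empty (A ++ (n + 1) :: M) E D (u := [⟨[], .crossing n m, []⟩])
        (v := [⟨[], .rightCusp k, []⟩]) (X := [n, m]) (X' := [m, n]) (Y := [k + 1, k])
        (Y' := []) ⟨rfl, rfl⟩ ⟨rfl, rfl⟩ (by simp)).congr_empty (S := S)
        (leftCuspWord A n M (m :: (E ++ (k + 1) :: k :: D))) []
      simpa using this
  · rcases E with _ | ⟨e, _ | ⟨f, E⟩⟩
    · obtain ⟨rfl, rfl, rfl⟩ : k + 1 = m ∧ k = n ∧ D = B := by simpa using hE
      obtain rfl : A ++ (k + 1) :: M = C := by simpa using hC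
      have := (Reduces.of_spn_empty (S := ∅)
        (spn_crossed_rightCusp (A ++ (k + 1) :: M) D k)).congr_empty (S := S)
        (leftCuspWord A k M ((k + 1) :: D)) []
      simpa using this
    · obtain ⟨rfl, rfl, rfl⟩ : k + 1 = e ∧ k = m ∧ D = n :: B := by simpa using hE
      -- The right cusp contains `m` but not the branch `n`. Its lower strand is either the lower
      -- branch of the left cusp, giving a first Reidemeister move, or a strand also crossed by the
      -- upper branch, giving a second one.
      rcases List.eq_nil_or_concat' M with rfl | ⟨M, x, rfl⟩
      · obtain ⟨rfl, e⟩ := List.append_inj' hC rfl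
        obtain rfl : n = k := by simpa using e
        exact Reduces.of_spn_lt (LocalMove.reidemeister1_below A B n).mv.spn
          (by simp [Lt, Basic.weight, Basic.src, Basic.tgt, Elem.src, Elem.tgt])
      · obtain ⟨hC', e⟩ := List.append_inj' (s₁ := A ++ (n + 1) :: M) (t₁ := [x])
          (s₂ := C) (t₂ := [k + 1]) (by simpa using hC) rfl
        obtain rfl : x = k + 1 := by simpa using e
        subst hC'
        have := (Reduces.of_spn_lt (S := ∅)
          (LocalMove.reidemeister2_right_below (A ++ (n + 1) :: M) B k n).mv.spn
          (by simp [Lt, Basic.weight, Basic.src, Basic.tgt, Elem.src, Elem.tgt]; omega)).congr_empty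
          (S := S) (leftCuspWord A n M ((k + 1) :: k :: B)) []
        simpa [leftCuspWord, up_append, up] using this
    · obtain ⟨rfl, rfl, rfl⟩ : k + 1 = e ∧ k = f ∧ D = E ++ m :: n :: B := by simpa using hE
      have := (reduces_interchange_symm_empty C E B (u := [⟨[], .rightCusp k, []⟩])
        (v := [⟨[], .crossing n m, []⟩]) (X := [k + 1, k]) (X' := []) (Y := [n, m])
        (Y' := [m, n]) ⟨rfl, rfl⟩ ⟨rfl, rfl⟩ (by simp)).congr_empty (S := S)
        (leftCuspWord A n M (m :: B)) []
      simpa [hC] using this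

theorem reduces_leftCusp_mir_leftCuspWord {A M B C D : List ℤ} {n k : ℤ}
    (h : A ++ (n + 1) :: (M ++ n :: B) = C ++ (k + 1) :: k :: D) (S : Set (List Basic)) :
    Reduces (⟨C, .leftCusp k, D⟩ :: mir (leftCuspWord A n M B)) S := by
  simpa [Basic.mirror, Elem.mirror] using (reduces_leftCuspWord_rightCusp h ∅).mir_empty (S := S)

/-- A standard left cusp tangle followed by a crossing. -/
theorem reduces_leftCuspWord_crossing {A M B C D : List ℤ} {n a b : ℤ}
    (h : A ++ (n + 1) :: (M ++ n :: B) = C ++ a :: b :: D) :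
    Reduces (leftCuspWord A n M B ++ [⟨C, .crossing a b, D⟩])
      {w | ∃ A' k M' B', w = leftCuspWord A' k M' B'} := by
  -- The crossings behind the left cusp, together with the new one, form a braid. Normalising it
  -- first leaves the case of a left cusp in front of a standard permutation braid.
  have hb : IsBraid (up (A ++ [n + 1]) n M B ++ [⟨C, .crossing a b, D⟩]) := by
    intro c hc
    rcases List.mem_append.1 hc with hc | hc
    · exact isBraid_up _ _ _ _ c hc
    · cases List.mem_singleton.1 hc
      trivial
  have hp : IsPath (A ++ (n + 1) :: n :: (M ++ B))
      (up (A ++ [n + 1]) n M B ++ [⟨C, .crossing a b, D⟩]) (C ++ b :: a :: D) := by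
    refine isPath_append (Y := C ++ a :: b :: D) ?_
      ⟨by simp [Basic.src, Elem.src], by simp [Basic.tgt, Elem.tgt, IsPath]⟩
    rw [← h]
    simpa using isPath_up (A ++ [n + 1]) n M B
  have := (hb.reduces hp).congr [⟨A, .leftCusp n, M ++ B⟩] []
  simp only [List.append_nil, List.cons_append, List.nil_append] at this
  rw [leftCuspWord, List.cons_append]
  refine this.trans ?_
  rintro _ ⟨p, hp, rfl⟩
  refine (PermWord.reduces_leftCusp hp).mono ?_
  rintro _ ⟨A', M', B', rfl, -⟩
  exact ⟨A', n, M', B', rfl⟩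

theorem reduces_crossing_mir_leftCuspWord {A M B C D : List ℤ} {n a b : ℤ}
    (h : A ++ (n + 1) :: (M ++ n :: B) = C ++ a :: b :: D) :
    Reduces (⟨C, .crossing b a, D⟩ :: mir (leftCuspWord A n M B))
      {w | ∃ A' k M' B', w = mir (leftCuspWord A' k M' B')} := by
  have := (reduces_leftCuspWord_crossing h).mir
  simp only [mir_append, mir_cons, mir_nil, List.nil_append, List.cons_append, Basic.mirror,
    Elem.mirror] at this
  refine this.mono ?_
  rintro _ ⟨_, ⟨A', k, M', B', rfl⟩, rfl⟩
  exact ⟨A', k, M', B', rfl⟩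

/-! ### Standard words -/

/-- Compositions of standard right cusp tangles. -/
inductive RightSeq : List ℤ → List Basic → List ℤ → Prop
  | nil (X : List ℤ) : RightSeq X [] X
  | cons (A : List ℤ) (k : ℤ) (M B : List ℤ) {w : List Basic} {Y : List ℤ} :
      RightSeq (A ++ (M ++ B)) w Y →
      RightSeq (A ++ (k + 1) :: (M ++ k :: B)) (mir (leftCuspWord A k M B) ++ w) Y

/-- Compositions of standard left cusp tangles. -/
inductive LeftSeq : List ℤ → List Basic → List ℤ → Prop
  | nil (X : List ℤ) : LeftSeq X [] X
  | snoc (A : List ℤ) (k : ℤ) (M B : List ℤ) {w : List Basic} {X : List ℤ} :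
      LeftSeq X w (A ++ (M ++ B)) →
      LeftSeq X (w ++ leftCuspWord A k M B) (A ++ (k + 1) :: (M ++ k :: B))

/-- Standard words. -/
def IsStd (X : List ℤ) (w : List Basic) (Y : List ℤ) : Prop :=
  ∃ X' Y' r p l, RightSeq X r X' ∧ PermWord X' p Y' ∧ LeftSeq Y' l Y ∧ w = r ++ p ++ l

theorem RightSeq.isPath {X Y : List ℤ} {w : List Basic} (h : RightSeq X w Y) : IsPath X w Y := by
  induction h with
  | nil => rfl
  | cons A k M B _ ih => exact isPath_append (isPath_mir_iff.2 (isPath_leftCuspWord A k M B)) ih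

theorem LeftSeq.isPath {X Y : List ℤ} {w : List Basic} (h : LeftSeq X w Y) : IsPath X w Y := by
  induction h with
  | nil => rfl
  | snoc A k M B _ ih => exact isPath_append ih (isPath_leftCuspWord A k M B)

theorem IsStd.isPath {X Y : List ℤ} {w : List Basic} (h : IsStd X w Y) : IsPath X w Y := by
  obtain ⟨X', Y', r, p, l, hr, hp, hl, rfl⟩ := h
  exact isPath_append (isPath_append hr.isPath hp.isPath) hl.isPath

theorem IsStd.cons {A M B Y : List ℤ} {k : ℤ} {w : List Basic} (h : IsStd (A ++ (M ++ B)) w Y) :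
    IsStd (A ++ (k + 1) :: (M ++ k :: B)) (mir (leftCuspWord A k M B) ++ w) Y := by
  obtain ⟨X', Y', r, p, l, hr, hp, hl, rfl⟩ := h
  exact ⟨X', Y', _, p, l, .cons A k M B hr, hp, hl, by simp⟩

theorem IsStd.snoc {A M B X : List ℤ} {k : ℤ} {w : List Basic} (h : IsStd X w (A ++ (M ++ B))) :
    IsStd X (w ++ leftCuspWord A k M B) (A ++ (k + 1) :: (M ++ k :: B)) := by
  obtain ⟨X', Y', r, p, l, hr, hp, hl, rfl⟩ := h
  exact ⟨X', Y', r, p, _, hr, hp, .snoc A k M B hl, by simp⟩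

theorem PermWord.isStd {X Y : List ℤ} {w : List Basic} (h : PermWord X w Y) : IsStd X w Y :=
  ⟨X, Y, [], w, [], .nil X, h, .nil Y, by simp⟩

theorem Basic.weight_pos (b : Basic) : 0 < b.weight := by
  rcases b with ⟨A, _ | _ | _, B⟩ <;>
    simp [Basic.weight, Basic.src, Basic.tgt, Elem.src, Elem.tgt]

/-- This feeds a reduction into the main induction: lower terms are handled by the induction
hypothesis, and leading terms need to be standard only if their ends are right. -/
theorem Reduces.spn_isStd {X Y : List ℤ} {w : List Basic} {S : Set (List Basic)}
    (hr : Reduces w S) (hp : IsPath X w Y) (hne : w ≠ [])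
    (ih : ∀ s, Lt s w → ∀ X Y, IsPath X s Y → Spn s {t | IsStd X t Y ∧ Le t s})
    (hS : ∀ s ∈ S, IsPath X s Y → IsStd X s Y) :
    Spn w {t | IsStd X t Y ∧ Le t w} := by
  refine (Spn.filter hp hne hr).trans ?_
  rintro s ⟨hs | ⟨hs, hsw⟩, hps⟩
  · exact (ih s hs X Y hps).mono fun t ht => ⟨ht.1, ht.2.trans hs.le⟩
  · exact Spn.of_mem ⟨hS s hs hps, hsw⟩

theorem spn_isStd (N : ℕ) : ∀ (w : List Basic), mu w ≤ N → ∀ X Y : List ℤ, IsPath X w Y →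
    Spn w {t | IsStd X t Y ∧ Le t w} := by
  induction N using Nat.strong_induction_on with
  | _ N IH =>
  intro w hwN X Y hp
  rcases w with _ | ⟨b, w⟩
  · cases hp
    exact Spn.of_mem ⟨(PermWord.id X).isStd, Le.refl _⟩
  obtain ⟨rfl, hp⟩ := hp
  have hwt := b.weight_pos
  rw [mu_cons] at hwN
  have h₁ := (IH (mu w) (by omega) w le_rfl _ _ hp).congr [b] []
  simp only [List.append_nil, List.cons_append, List.nil_append] at h₁
  refine h₁.trans ?_
  rintro _ ⟨s, ⟨hs, hsw⟩, rfl⟩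
  have hle : Le (b :: s) (b :: w) := by
    have := hsw.congr [b] []
    simpa using this
  suffices h : Spn (b :: s) {t | IsStd b.src t Y ∧ Le t (b :: s)} from
    h.mono fun t ht => ⟨ht.1, ht.2.trans hle⟩
  have ih : ∀ t, Lt t (b :: s) → ∀ X Y, IsPath X t Y → Spn t {t' | IsStd X t' Y ∧ Le t' t} := by
    intro t ht X Y hX
    refine IH (mu t) ?_ t le_rfl X Y hX
    have := ht.2
    have := hle.2
    simp only [mu_cons] at *
    omega
  have hps : IsPath b.src (b :: s) Y := ⟨rfl, hs.isPath⟩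
  clear h₁ hp IH hwN hle hsw hwt
  obtain ⟨X', Y', r, p, l, hr, hpm, hl, rfl⟩ := hs
  -- If the standard word ends in a left cusp tangle, the letters before it are less complex even
  -- with `b` in front. They are normalised by induction and the cusp tangle is put back.
  cases hl with
  | @snoc A k M B l _ hl =>
    have hq : IsPath b.src (b :: (r ++ p ++ l)) (A ++ (M ++ B)) :=
      ⟨rfl, isPath_append (isPath_append hr.isPath hpm.isPath) hl.isPath⟩
    have hlt : Lt (b :: (r ++ p ++ l)) (b :: (r ++ p ++ (l ++ leftCuspWord A k M B))) := by
      have := Basic.weight_pos ⟨A, .leftCusp k, M ++ B⟩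
      simp [Lt, leftCuspWord]
      omega
    have := (ih _ hlt _ _ hq).congr [] (leftCuspWord A k M B)
    simp only [List.append_assoc, List.nil_append, List.cons_append] at this ⊢
    refine this.mono ?_
    rintro _ ⟨t, ⟨ht, hts⟩, rfl⟩
    refine ⟨ht.snoc, ?_⟩
    have := hts.congr [] (leftCuspWord A k M B)
    simpa using this
  | nil =>
    rw [List.append_nil] at *
    have hstd : IsStd b.tgt (r ++ p) Y := ⟨X', Y, r, p, [], hr, hpm, .nil _, by simp⟩
    rcases b with ⟨A, ⟨a, b⟩ | k | k, B⟩
    · generalize hZ : Basic.tgt ⟨A, .crossing a b, B⟩ = Z at hr hstd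
      cases hr with
      | nil =>
        subst hZ
        have hpm' : PermWord (A ++ b :: a :: B) p Y := by simpa [Basic.tgt, Elem.tgt] using hpm
        refine hpm'.reduces_crossing.spn_isStd hps (by simp) ih ?_
        intro s hs hps'
        have hs' : PermWord (A ++ a :: b :: B) s Y := hs
        simpa [Basic.src, Elem.src] using hs'.isStd
      | @cons A' k M B' r _ hr =>
        have hZ' : A' ++ (k + 1) :: (M ++ k :: B') = A ++ b :: a :: B := by
          simpa [Basic.tgt, Elem.tgt] using hZ.symm
        have := (reduces_crossing_mir_leftCuspWord hZ').congr [] (r ++ p)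
        simp only [List.append_assoc, List.nil_append, List.cons_append] at this hps ⊢ ih
        refine this.spn_isStd hps (by simp) ih ?_
        rintro _ ⟨_, ⟨A₁, k₁, M₁, B₁, rfl⟩, rfl⟩ hps'
        obtain ⟨W, hW₁, hW₂⟩ := isPath_append_iff.1 hps'
        obtain ⟨e₁, e₂⟩ := (isPath_mir_iff.1 hW₁).leftCuspWord_ends
        have e₃ := hW₂.src_unique (isPath_append hr.isPath hpm.isPath)
        rw [e₂]
        refine IsStd.cons ?_
        rw [← e₁, e₃]
        exact ⟨X', Y, r, p, [], hr, hpm, .nil _, by simp⟩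
    · generalize hZ : Basic.tgt ⟨A, .leftCusp k, B⟩ = Z at hr hstd
      cases hr with
      | nil =>
        subst hZ
        have hpm' : PermWord (A ++ (k + 1) :: k :: B) p Y := by
          simpa [Basic.tgt, Elem.tgt] using hpm
        refine hpm'.reduces_leftCusp.spn_isStd hps (by simp) ih ?_
        rintro _ ⟨A', M, B', rfl, rfl⟩ hps'
        have e := hps'.src_unique (isPath_leftCuspWord A' k M B')
        rw [e]
        exact (PermWord.id _).isStd.snoc
      | @cons A' k' M B' r _ hr =>
        have hZ' : A' ++ (k' + 1) :: (M ++ k' :: B') = A ++ (k + 1) :: k :: B := by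
          simpa [Basic.tgt, Elem.tgt] using hZ.symm
        have := (reduces_leftCusp_mir_leftCuspWord hZ' ∅).congr_empty (S := ∅) [] (r ++ p)
        simp only [List.append_assoc, List.nil_append, List.cons_append] at this hps ⊢ ih
        exact this.spn_isStd hps (by simp) ih (by simp)
    · refine Spn.of_mem ⟨?_, Le.refl _⟩
      -- A bare right cusp is a right cusp tangle whose branches enclose no strands.
      have := IsStd.cons (A := A) (M := []) (B := B) (k := k) (w := r ++ p) (Y := Y)
        (by simpa [Basic.tgt, Elem.tgt] using hstd)
      simpa [leftCuspWord, Basic.mirror, Elem.mirror, Basic.src, Elem.src] using this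

/-! ### Standard words are normal forms -/

/-- The effect on heights of a crossing between the strands at heights `p` and `p + 1`. -/
def swapHeight (p i : ℕ) : ℕ := if i = p then p + 1 else if i = p + 1 then p else i

/-- The effect on heights of a word of crossings. -/
def run : List Basic → ℕ → ℕ
  | [], i => i
  | b :: w, i => run w (swapHeight b.lower.length i)

theorem Basic.follow_of_isCrossing {b : Basic} (hb : b.elem.IsCrossing) (i : ℕ) :
    b.follow i = some (swapHeight b.lower.length i) := by
  rcases b with ⟨A, _ | _ | _, B⟩
  · simp only [follow, swapHeight]
    split_ifs <;> rfl
  · exact hb.elim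
  · exact hb.elim

theorem followWord_of_isBraid {w : List Basic} (hw : IsBraid w) (i : ℕ) :
    followWord w i = some (run w i) := by
  induction w generalizing i with
  | nil => rfl
  | cons b w ih =>
    rw [followWord, Basic.follow_of_isCrossing (hw b List.mem_cons_self)]
    exact ih (fun c hc => hw c (List.mem_cons_of_mem _ hc)) _

theorem crossingNumber_cons {b : Basic} (hb : b.elem.IsCrossing) (w : List Basic) (i j : ℕ) :
    crossingNumber (b :: w) i j =
      (if (i = b.lower.length ∧ j = b.lower.length + 1) ∨
        (j = b.lower.length ∧ i = b.lower.length + 1) then 1 else 0) +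
      crossingNumber w (swapHeight b.lower.length i) (swapHeight b.lower.length j) := by
  simp only [crossingNumber, Basic.follow_of_isCrossing hb, Option.elim_some, Basic.Crosses, hb,
    true_and]

theorem run_append (u v : List Basic) (i : ℕ) : run (u ++ v) i = run v (run u i) := by
  induction u generalizing i with
  | nil => rfl
  | cons b u ih => exact ih _

theorem crossingNumber_append {u : List Basic} (hu : IsBraid u) (v : List Basic) (i j : ℕ) :
    crossingNumber (u ++ v) i j =
      crossingNumber u i j + crossingNumber v (run u i) (run u j) := by
  induction u generalizing i j with
  | nil => simp [crossingNumber, run]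
  | cons b u ih =>
    have hb := hu b List.mem_cons_self
    rw [List.cons_append, crossingNumber_cons hb, crossingNumber_cons hb,
      ih (fun c hc => hu c (List.mem_cons_of_mem _ hc)), add_assoc]
    rfl

theorem crossingNumber_comm {w : List Basic} (hw : IsBraid w) (i j : ℕ) :
    crossingNumber w i j = crossingNumber w j i := by
  induction w generalizing i j with
  | nil => rfl
  | cons b w ih =>
    have hb := hw b List.mem_cons_self
    rw [crossingNumber_cons hb, crossingNumber_cons hb,
      ih (fun c hc => hw c (List.mem_cons_of_mem _ hc))]
    simp only [or_comm]

theorem swapHeight_succ (p i : ℕ) : swapHeight (p + 1) (i + 1) = swapHeight p i + 1 := by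
  simp only [swapHeight]
  split_ifs <;> omega

theorem run_whisk_succ (x : ℤ) (w : List Basic) (i : ℕ) :
    run (whisk [x] [] w) (i + 1) = run w i + 1 := by
  induction w generalizing i with
  | nil => rfl
  | cons b w ih => simp [run, swapHeight_succ, ih]

theorem IsBraid.whisk {w : List Basic} (hw : IsBraid w) (A B : List ℤ) :
    IsBraid (whisk A B w) := by
  intro b hb
  obtain ⟨c, hc, rfl⟩ := List.mem_map.1 hb
  exact hw c hc

theorem crossingNumber_whisk_succ {w : List Basic} (hw : IsBraid w) (x : ℤ) (i j : ℕ) :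
    crossingNumber (whisk [x] [] w) (i + 1) (j + 1) = crossingNumber w i j := by
  induction w generalizing i j with
  | nil => rfl
  | cons b w ih =>
    have hb := hw b List.mem_cons_self
    rw [whisk_cons, crossingNumber_cons (by exact hb), crossingNumber_cons hb]
    simp [swapHeight_succ, ih (fun c hc => hw c (List.mem_cons_of_mem _ hc))]

theorem crossingNumber_whisk_zero {w : List Basic} (hw : IsBraid w) (x : ℤ) (j : ℕ) :
    crossingNumber (whisk [x] [] w) 0 j = 0 := by
  induction w generalizing j with
  | nil => rfl
  | cons b w ih =>
    have hb := hw b List.mem_cons_self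
    have e : swapHeight (b.lower.length + 1) 0 = 0 := by simp [swapHeight]
    rw [whisk_cons, crossingNumber_cons (by exact hb)]
    simp [e, ih (fun c hc => hw c (List.mem_cons_of_mem _ hc))]

theorem crossingNumber_up (A : List ℤ) (x : ℤ) (M B : List ℤ) (i j : ℕ) :
    crossingNumber (up A x M B) i j =
      if (i = A.length ∧ A.length < j ∧ j ≤ A.length + M.length) ∨
        (j = A.length ∧ A.length < i ∧ i ≤ A.length + M.length) then 1 else 0 := by
  induction M generalizing A i j with
  | nil =>
    rw [up_nil, if_neg (by simp)]
    rfl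
  | cons m M ih =>
    rw [up, crossingNumber_cons (by trivial), ih]
    simp only [swapHeight, List.length_append, List.length_cons, List.length_nil]
    split_ifs <;> omega

/-- The bottom strand is idle in the first factor and passes each strand at most once in the second.
The other pairs meet only in the first factor, where the induction hypothesis applies. -/
theorem PermWord.crossingNumber_le {X Y : List ℤ} {w : List Basic} (h : PermWord X w Y) (i j : ℕ) :
    crossingNumber w i j ≤ 1 := by
  induction h generalizing i j with
  | nil => simp [crossingNumber]
  | @cons X w x M B hw ih =>
    have hb := hw.isBraid
    rw [crossingNumber_append (hb.whisk _ _)]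
    rcases i with _ | i
    · rw [crossingNumber_whisk_zero hb, crossingNumber_up]
      split_ifs <;> omega
    rcases j with _ | j
    · rw [crossingNumber_comm (hb.whisk _ _), crossingNumber_whisk_zero hb, crossingNumber_up]
      split_ifs <;> omega
    · have := ih i j
      rw [crossingNumber_whisk_succ hb, crossingNumber_up, run_whisk_succ, run_whisk_succ,
        if_neg (by simp)]
      omega

theorem IsBraid.mir {w : List Basic} (hw : IsBraid w) : IsBraid (mir w) := by
  intro b hb
  obtain ⟨c, hc, rfl⟩ := List.mem_map.1 hb
  have := hw c (List.mem_reverse.1 hc)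
  rcases c with ⟨A, _ | _ | _, B⟩
  · trivial
  · exact this.elim
  · exact this.elim

theorem run_mir_up (A : List ℤ) (x : ℤ) (M B : List ℤ) (i : ℕ) :
    run (mir (up A x M B)) i = if i = A.length + M.length then A.length else
      if A.length ≤ i ∧ i < A.length + M.length then i + 1 else i := by
  induction M generalizing A with
  | nil =>
    simp only [up_nil, mir_nil, run, List.length_nil]
    split_ifs <;> omega
  | cons m M ih =>
    rw [up, mir_cons, run_append, ih]
    simp only [run, swapHeight, Basic.mirror, List.length_append, List.length_cons,
      List.length_nil]
    split_ifs <;> omega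

theorem crossingNumber_mir_up (A : List ℤ) (x : ℤ) (M B : List ℤ) (i j : ℕ) :
    crossingNumber (mir (up A x M B)) i j =
      if (i = A.length + M.length ∧ A.length ≤ j ∧ j < A.length + M.length) ∨
        (j = A.length + M.length ∧ A.length ≤ i ∧ i < A.length + M.length) then 1 else 0 := by
  induction M generalizing A i j with
  | nil =>
    rw [up_nil, if_neg (by simp)]
    rfl
  | cons m M ih =>
    rw [up, mir_cons, crossingNumber_append (isBraid_up _ _ _ _).mir, ih, run_mir_up, run_mir_up,
      crossingNumber_cons (by trivial)]
    simp only [crossingNumber, Basic.mirror, List.length_append, List.length_cons,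
      List.length_nil]
    split_ifs <;> omega

theorem crossingNumber_rightCusp (A : List ℤ) (k : ℤ) (B : List ℤ) (i j : ℕ) :
    crossingNumber [⟨A, .rightCusp k, B⟩] i j = 0 := by
  simp only [crossingNumber, Basic.Crosses, Elem.IsCrossing, false_and, if_false, zero_add]
  cases Basic.follow ⟨A, .rightCusp k, B⟩ i <;> cases Basic.follow ⟨A, .rightCusp k, B⟩ j <;> rfl

theorem isRightCuspTangle_of_word {X Y A M B : List ℤ} {k : ℤ} {T : Tangle X Y}
    (hT : T.word = mir (leftCuspWord A k M B)) : T.IsRightCuspTangle := by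
  have hw : T.word = mir (up (A ++ [k + 1]) k M B) ++ [⟨A, .rightCusp k, M ++ B⟩] := hT.trans
    (by simp [leftCuspWord, Basic.mirror, Elem.mirror])
  have hb : IsBraid (mir (up (A ++ [k + 1]) k M B)) := (isBraid_up _ _ _ _).mir
  have hc : ∀ i j, crossingNumber T.word i j =
      crossingNumber (mir (up (A ++ [k + 1]) k M B)) i j := fun i j => by
    rw [hw, crossingNumber_append hb, crossingNumber_rightCusp, add_zero]
  -- The lower branch starts at height `A.length`. The upper branch starts above it and the bunch
  -- `M`, and comes down through `M` to the cusp.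
  refine ⟨mir (up (A ++ [k + 1]) k M B), [], A, M ++ B, k, A.length, A.length + 1 + M.length,
    by simp [hw], fun c hc => hb c (by simpa using hc), ?_, ?_, ?_, ?_, ?_⟩
  · rw [followWord_of_isBraid hb, run_mir_up]
    simp
    omega
  · rw [followWord_of_isBraid hb, run_mir_up]
    simp
  · rw [hc, crossingNumber_mir_up, if_neg]
    simp
  · intro a b ha ha' hb hb'
    rw [hc, crossingNumber_mir_up, if_neg]
    simp only [List.length_append, List.length_cons, List.length_nil]
    omega
  · intro a b
    rw [hc, crossingNumber_mir_up]
    split_ifs <;> omega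

theorem isLeftCuspTangle_of_word {X Y A M B : List ℤ} {k : ℤ} {T : Tangle X Y}
    (hT : T.word = leftCuspWord A k M B) : T.IsLeftCuspTangle :=
  isRightCuspTangle_of_word (A := A) (M := M) (B := B) (k := k) (congrArg mir hT)

theorem RightSeq.isRightCuspSequence {X Y : List ℤ} {w : List Basic} (h : RightSeq X w Y) :
    (⟨w, h.isPath⟩ : Tangle X Y).IsRightCuspSequence := by
  induction h with
  | nil X => exact .id X
  | cons A k M B h ih =>
    exact .comp ⟨_, isPath_mir_iff.2 (isPath_leftCuspWord A k M B)⟩ _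
      (isRightCuspTangle_of_word rfl) ih

theorem Tangle.IsLeftCuspSequence.snoc {X Y Z : List ℤ} {S : Tangle X Y} {T : Tangle Y Z}
    (hS : S.IsLeftCuspSequence) (hT : T.IsLeftCuspTangle) : (S.comp T).IsLeftCuspSequence := by
  induction hS with
  | id X =>
    have e : (Tangle.id X).comp T = T.comp (Tangle.id Z) :=
      Tangle.ext (by simp [Tangle.comp, Tangle.id])
    rw [e]
    exact .comp _ _ hT (.id Z)
  | comp S S' hS _ ih =>
    have e : (S.comp S').comp T = S.comp (S'.comp T) :=
      Tangle.ext (by simp [Tangle.comp])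
    rw [e]
    exact .comp _ _ hS (ih hT)

theorem LeftSeq.isLeftCuspSequence {X Y : List ℤ} {w : List Basic} (h : LeftSeq X w Y) :
    (⟨w, h.isPath⟩ : Tangle X Y).IsLeftCuspSequence := by
  induction h with
  | nil X => exact .id X
  | snoc A k M B h ih =>
    exact ih.snoc (T := ⟨_, isPath_leftCuspWord A k M B⟩) (isLeftCuspTangle_of_word rfl)

theorem IsStd.isNormalForm {X Y : List ℤ} {w : List Basic} (h : IsStd X w Y) :
    (⟨w, h.isPath⟩ : Tangle X Y).IsNormalForm := by
  obtain ⟨X', Y', r, p, l, hr, hp, hl, rfl⟩ := id h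
  exact ⟨X', Y', ⟨r, hr.isPath⟩, ⟨p, hp.isPath⟩, ⟨l, hl.isPath⟩, hr.isRightCuspSequence,
    ⟨hp.isBraid, hp.crossingNumber_le⟩, hl.isLeftCuspSequence, rfl⟩

theorem toSkein_mem_span {X Y : List ℤ} (T : Tangle X Y) :
    T.toSkein ∈ Submodule.span SkeinRing
      {x : Skein X Y | ∃ T : Tangle X Y, T.IsNormalForm ∧ T.toSkein = x} := by
  -- The empty context without reflection extracts the statement about the tangle itself.
  have h := spn_isStd _ T.word le_rfl X Y T.isPath false [] [] [] [] X Y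
  simp only [tr_false, whisk_nil_nil, List.nil_append, List.append_nil] at h
  rw [cls_of_isPath T.isPath] at h
  refine Submodule.span_mono ?_ h
  rintro _ ⟨s, ⟨hs, -⟩, rfl⟩
  exact ⟨_, hs.isNormalForm, (cls_of_isPath hs.isPath).symm⟩

end LegendrianTangle

theorem proposition3p3 (X Y : List ℤ) :
    Submodule.span LegendrianTangle.SkeinRing
      {x : LegendrianTangle.Skein X Y |
        ∃ T : LegendrianTangle.Tangle X Y, T.IsNormalForm ∧ T.toSkein = x} = ⊤ := by
  rw [eq_top_iff]
  rintro x -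
  obtain ⟨f, rfl⟩ := Submodule.Quotient.mk_surjective _ x
  induction f using Finsupp.induction_linear with
  | zero => exact zero_mem _
  | add f g hf hg =>
    rw [Submodule.Quotient.mk_add]
    exact add_mem hf hg
  | single c r =>
    obtain ⟨T, hT⟩ : ∃ T : LegendrianTangle.Tangle X Y, T.isotopyClass = c := Quot.exists_rep c
    have e : Finsupp.single c r = r • T.free := by
      rw [LegendrianTangle.Tangle.free, Finsupp.smul_single, smul_eq_mul, mul_one, hT]
    rw [e, Submodule.Quotient.mk_smul]
    exact Submodule.smul_mem _ _ (LegendrianTangle.toSkein_mem_span T)
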